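/- Theorem 1.2. Call two functions $p,q:\mathbb{R}^2\to\mathbb{R}$ equivalent if there are an affine change of coordinates $T:\mathbb{R}^2\to\mathbb{R}^2$ (a map $v\mapsto Av+b$ with $A$ an invertible real $2\times 2$ matrix and $b\in\mathbb{R}^2$) and constants $M,N\in\mathbb{R}$ with $M\neq 0$ such that $p(x,y)=M\,q(T^{-1}(x,y))+N$ for all $(x,y)\in\mathbb{R}^2$. Let $p:\mathbb{R}^2\to\mathbb{R}$ be a polynomial function of degree exactly $4$ which is a submersion (its differential is surjective, i.e. nonzero, at every point of $\mathbb{R}^2$) and which has at least one disconnected level set $p^{-1}\{c\}$, $c\in\mathbb{R}$. Then $p$ is equivalent to one of the following polynomials: 1. $y+xy^2+y^4$; 2. $y+a\,y^2+xy^3$ with $a=0$ or $a=1$; 3. $y+x^2y^2$; 4. $y+a\,y^2+y^3+x^2y^2$ for some $a\in\mathbb{R}$ with $a^2<3$. -/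

import Mathlib

/-- `f : ℝ² → ℝ` is a polynomial function of (exact, total) degree `n`. -/
def IsPolynomialOfDegree (f : ℝ × ℝ → ℝ) (n : ℕ) : Prop :=
  ∃ P : MvPolynomial (Fin 2) ℝ, P.totalDegree = n ∧
    ∀ x y : ℝ, f (x, y) = MvPolynomial.eval ![x, y] P

/-- `f : ℝ² → ℝ` is a (smooth) submersion: its differential is surjective at every point. -/
def IsPlaneSubmersion (f : ℝ × ℝ → ℝ) : Prop :=
  ContDiff ℝ (⊤ : ℕ∞) f ∧ ∀ z : ℝ × ℝ, Function.Surjective (fderiv ℝ f z)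

/-- Some level set of `f` is disconnected, i.e. is the union of two disjoint nonempty relatively
open subsets. (The empty set is not disconnected.) -/
def HasDisconnectedLevelSet (f : ℝ × ℝ → ℝ) : Prop :=
  ∃ c : ℝ, ¬ IsPreconnected (f ⁻¹' {c})

/-- Equivalence of functions on the plane up to affine changes of coordinates in the source and in
the target: `p = M * (q ∘ T⁻¹) + N` with `T` an invertible affine map of `ℝ²` and `M ≠ 0`. -/
def AffinelyEquivalent (p q : ℝ × ℝ → ℝ) : Prop :=
  ∃ (T : (ℝ × ℝ) ≃ᵃ[ℝ] (ℝ × ℝ)) (M N : ℝ), M ≠ 0 ∧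
    ∀ z : ℝ × ℝ, p z = M * q (T.symm z) + N

/-! If the gradient of p is bounded away from zero, the field ∇p/|∇p|² is bounded and p grows at
unit speed along it. Moving each point z for time c - p(z) sends the plane continuously onto the
level c and fixes that level, so levels are connected (`isPreconnected_level_of_bounded_lift`). A
submersion with a disconnected level therefore has a gradient tending to zero along some sequence
going to infinity: it is not `Tame`.

Tameness is tested by weighted homogeneity (`tame_of_weights`). For equal weights, failure means
that the leading form has a nonzero critical point, hence a repeated real linear factor, which a
rotation turns into y². Up to scaling and affine changes three leading forms remain: y⁴, xy³ (plus a
multiple of y⁴) and x²y² + εy⁴.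

For the first two, other weights leave only polynomials xA(y) + r(y), apart from a case where
completing the square shows connectedness. Here A has a zero, since otherwise the levels are graphs
over the y-axis, and every zero of A is multiple, since otherwise there is a critical point. This
determines A, and affine changes normalize r.

For x²y² + εy⁴ no single weight suffices, and explicit estimates bound the region where both partial
derivatives are small. The survivors, up to exchanging the variables, are x²y² + r(y) with r' free
of zeros, so that r is linear or a cubic with strictly monotone graph. -/

/-! ### Connected levels from a bounded lift of the unit field -/

/-- A function on the plane which increases at unit speed along a bounded `C¹` vector field has
connected level sets: every level set is, locally, the continuous image of a ball. -/
theorem isPreconnected_level_of_bounded_lift {f : ℝ × ℝ → ℝ} {v : ℝ × ℝ → ℝ × ℝ} {L : ℝ}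
    (hf : Differentiable ℝ f) (hv : ContDiff ℝ 1 v) (hL : ∀ z, ‖v z‖ ≤ L)
    (hfv : ∀ z, fderiv ℝ f z (v z) = 1) (c : ℝ) : IsPreconnected (f ⁻¹' {c}) := by
  have hL0 : 0 ≤ L := (norm_nonneg _).trans (hL 0)
  refine isPreconnected_of_forall_pair fun x hx y hy => ?_
  obtain ⟨r, hr0, hxr, hyr⟩ : ∃ r : ℝ, 0 ≤ r ∧ x ∈ Metric.closedBall (0 : ℝ × ℝ) r ∧
      y ∈ Metric.closedBall (0 : ℝ × ℝ) r :=
    ⟨max ‖x‖ ‖y‖, by positivity, by simp, by simp⟩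
  obtain ⟨C, hC⟩ := (isCompact_closedBall (0 : ℝ × ℝ) r).exists_bound_of_continuousOn
    (f := fun z => c - f z) (continuous_const.sub hf.continuous).continuousOn
  have hC0 : 0 ≤ C := (norm_nonneg _).trans (hC x hxr)
  -- A trajectory starting in the ball of radius `r` moves by at most `L * C` in time `C`, so it
  -- stays in this larger ball.
  obtain ⟨K, hK⟩ := (hv.contDiffOn (s := Metric.closedBall (0 : ℝ × ℝ) (L * C + r)))
    |>.exists_lipschitzOnWith one_ne_zero (convex_closedBall _ _) (isCompact_closedBall _ _)
  have h0 : (0 : ℝ) ∈ Set.Icc (-C) C := ⟨by linarith, hC0⟩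
  have hPL : IsPicardLindelof (fun _ => v) (⟨0, h0⟩ : Set.Icc (-C) C) (0 : ℝ × ℝ)
      ⟨L * C + r, by positivity⟩ ⟨r, hr0⟩ ⟨L, hL0⟩ K := by
    refine IsPicardLindelof.of_time_independent (fun z _ => hL z) hK ?_
    show L * max (C - 0) (0 - (-C)) ≤ (L * C + r) - r
    simp
  obtain ⟨α, hα, hαc⟩ := hPL.exists_forall_mem_closedBall_eq_hasDerivWithinAt_continuousOn
  have key : ∀ z ∈ Metric.closedBall (0 : ℝ × ℝ) r, ∀ t ∈ Set.Icc (-C) C,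
      f (α (z, t)) = f z + t := by
    intro z hz t ht
    obtain ⟨hz0, hzd⟩ := hα z hz
    have hd : ∀ t ∈ Set.Icc (-C) C,
        HasDerivWithinAt (fun s => f (α (z, s)) - s) 0 (Set.Icc (-C) C) t := by
      intro s hs
      have := ((hf (α (z, s))).hasFDerivAt.comp_hasDerivWithinAt s (hzd s hs)).sub
        (hasDerivWithinAt_id s _)
      rw [hfv, sub_self] at this
      exact this
    have := (convex_Icc (-C) C).norm_image_sub_le_of_norm_hasDerivWithin_le (C := 0) hd
      (fun _ _ => by simp) h0 ht
    have h1 : f (α (z, t)) - t - (f (α (z, 0)) - 0) = 0 := by simpa using this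
    have hz0' : α (z, 0) = z := hz0
    rw [hz0'] at h1
    linarith
  have hmem : ∀ z ∈ Metric.closedBall (0 : ℝ × ℝ) r, c - f z ∈ Set.Icc (-C) C := fun z hz =>
    abs_le.mp (hC z hz)
  -- Time `c - f z` is exactly what takes `z` to the level `c`; joint continuity of the local flow
  -- makes this map continuous.
  have hπ : ContinuousOn (fun z => α (z, c - f z)) (Metric.closedBall (0 : ℝ × ℝ) r) :=
    hαc.comp (continuous_id.prodMk (continuous_const.sub hf.continuous)).continuousOn
      fun z hz => ⟨hz, hmem z hz⟩
  have hfix : ∀ z ∈ Metric.closedBall (0 : ℝ × ℝ) r, f z = c → α (z, c - f z) = z := by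
    intro z hz hzc
    rw [hzc, sub_self]
    exact (hα z hz).1
  refine ⟨(fun z => α (z, c - f z)) '' Metric.closedBall (0 : ℝ × ℝ) r, ?_,
    ⟨x, hxr, hfix x hxr hx⟩, ⟨y, hyr, hfix y hyr hy⟩,
    (convex_closedBall _ _).isPreconnected.image _ hπ⟩
  rintro _ ⟨z, hz, rfl⟩
  show f (α (z, c - f z)) = c
  rw [key z hz _ (hmem z hz)]
  ring

/-! ### Normal forms and invariance under affine equivalence -/

/-- The conclusion of the classification. -/
def IsNormalizable (p : ℝ × ℝ → ℝ) : Prop :=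
  AffinelyEquivalent p (fun z => z.2 + z.1 * z.2 ^ 2 + z.2 ^ 4) ∨
    (∃ a : ℝ, (a = 0 ∨ a = 1) ∧
      AffinelyEquivalent p (fun z => z.2 + a * z.2 ^ 2 + z.1 * z.2 ^ 3)) ∨
    AffinelyEquivalent p (fun z => z.2 + z.1 ^ 2 * z.2 ^ 2) ∨
    (∃ a : ℝ, a ^ 2 < 3 ∧
      AffinelyEquivalent p (fun z => z.2 + a * z.2 ^ 2 + z.2 ^ 3 + z.1 ^ 2 * z.2 ^ 2))

/-- The classification holds for the function `p`. -/
def Classified (p : ℝ × ℝ → ℝ) : Prop :=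
  IsPlaneSubmersion p → HasDisconnectedLevelSet p → IsNormalizable p

namespace AffinelyEquivalent

variable {p q r : ℝ × ℝ → ℝ}

theorem trans (h : AffinelyEquivalent p q) (h' : AffinelyEquivalent q r) :
    AffinelyEquivalent p r := by
  obtain ⟨T, M, N, hM, h⟩ := h
  obtain ⟨T', M', N', hM', h'⟩ := h'
  refine ⟨T'.trans T, M * M', M * N' + N, mul_ne_zero hM hM', fun z => ?_⟩
  rw [h, h']
  show _ = M * M' * r (T'.symm (T.symm z)) + _
  ring

theorem symm (h : AffinelyEquivalent p q) : AffinelyEquivalent q p := by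
  obtain ⟨T, M, N, hM, h⟩ := h
  refine ⟨T.symm, M⁻¹, -(M⁻¹ * N), inv_ne_zero hM, fun z => ?_⟩
  have hz : T.symm (T z) = z := T.symm_apply_apply z
  show q z = M⁻¹ * p (T z) + _
  rw [h, hz]
  field_simp
  ring

/-- Two functions are equivalent if a non-degenerate affine substitution in one gives the other up
to an affine transformation of the target. -/
theorem of_substitution {M N a b c d s t : ℝ} (hM : M ≠ 0) (hdet : a * d - b * c ≠ 0)
    (h : ∀ x y, p (a * x + b * y + s, c * x + d * y + t) = M * q (x, y) + N) :
    AffinelyEquivalent p q := by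
  let A : (ℝ × ℝ) ≃ₗ[ℝ] (ℝ × ℝ) :=
    { toFun := fun z => (a * z.1 + b * z.2, c * z.1 + d * z.2)
      invFun := fun z => ((d * z.1 - b * z.2) / (a * d - b * c),
        (a * z.2 - c * z.1) / (a * d - b * c))
      map_add' := fun z w => by ext <;> simp <;> ring
      map_smul' := fun k z => by ext <;> simp <;> ring
      left_inv := fun z => Prod.ext
        (by
          show (d * (a * z.1 + b * z.2) - b * (c * z.1 + d * z.2)) / (a * d - b * c) = z.1
          rw [div_eq_iff hdet]
          ring)
        (by
          show (a * (c * z.1 + d * z.2) - c * (a * z.1 + b * z.2)) / (a * d - b * c) = z.2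
          rw [div_eq_iff hdet]
          ring)
      right_inv := fun z => Prod.ext
        (by
          show a * ((d * z.1 - b * z.2) / (a * d - b * c)) +
            b * ((a * z.2 - c * z.1) / (a * d - b * c)) = z.1
          rw [← mul_div_assoc, ← mul_div_assoc, ← add_div, div_eq_iff hdet]
          ring)
        (by
          show c * ((d * z.1 - b * z.2) / (a * d - b * c)) +
            d * ((a * z.2 - c * z.1) / (a * d - b * c)) = z.2
          rw [← mul_div_assoc, ← mul_div_assoc, ← add_div, div_eq_iff hdet]
          ring) }
  let T : (ℝ × ℝ) ≃ᵃ[ℝ] (ℝ × ℝ) := A.toAffineEquiv.trans (AffineEquiv.constVAdd ℝ (ℝ × ℝ) (s, t))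
  refine ⟨T, M, N, hM, fun z => ?_⟩
  obtain ⟨w, rfl⟩ := T.surjective z
  rw [AffineEquiv.symm_apply_apply, ← h w.1 w.2]
  congr 1
  show ((s, t) : ℝ × ℝ) + (a * w.1 + b * w.2, c * w.1 + d * w.2) = _
  ext <;> simp <;> ring

theorem comp_swap (p : ℝ × ℝ → ℝ) : AffinelyEquivalent p (fun z => p (z.2, z.1)) :=
  of_substitution (M := 1) (N := 0) (a := 0) (b := 1) (c := 1) (d := 0) (s := 0) (t := 0)
    one_ne_zero (by norm_num) (by simp)

theorem isNormalizable (h : AffinelyEquivalent p q) (hq : IsNormalizable q) :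
    IsNormalizable p := by
  rcases hq with hq | ⟨a, ha, hq⟩ | hq | ⟨a, ha, hq⟩
  · exact Or.inl (h.trans hq)
  · exact Or.inr (Or.inl ⟨a, ha, h.trans hq⟩)
  · exact Or.inr (Or.inr (Or.inl (h.trans hq)))
  · exact Or.inr (Or.inr (Or.inr ⟨a, ha, h.trans hq⟩))

theorem isPlaneSubmersion (h : AffinelyEquivalent p q) (hq : IsPlaneSubmersion q) :
    IsPlaneSubmersion p := by
  obtain ⟨T, M, N, hM, h⟩ := h
  let S : (ℝ × ℝ) →ᴬ[ℝ] (ℝ × ℝ) := T.symm.toContinuousAffineEquiv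
  have hp : p = fun z => M * q (S z) + N := funext h
  have hS : ∀ z, HasFDerivAt S S.contLinear z := fun z => S.hasFDerivAt
  refine ⟨?_, fun z => ?_⟩
  · rw [hp]
    exact (contDiff_const.mul (hq.1.comp S.contDiff)).add contDiff_const
  · have hqd : DifferentiableAt ℝ q (S z) := hq.1.differentiable (by simp) _
    have := ((hqd.hasFDerivAt.comp z (hS z)).const_mul M).add_const N
    have hfd : fderiv ℝ p z = M • (fderiv ℝ q (S z)).comp S.contLinear := by
      rw [hp]
      exact this.fderiv
    intro c
    obtain ⟨w, hw⟩ := hq.2 (S z) (M⁻¹ * c)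
    obtain ⟨u, hu⟩ := T.symm.linear.surjective w
    refine ⟨u, ?_⟩
    have hu' : S.contLinear u = w := hu
    rw [hfd]
    simp [hu', hw, hM]

theorem hasDisconnectedLevelSet (h : AffinelyEquivalent p q) (hq : HasDisconnectedLevelSet q) :
    HasDisconnectedLevelSet p := by
  obtain ⟨T, M, N, hM, h⟩ := h
  obtain ⟨c, hc⟩ := hq
  refine ⟨M * c + N, fun hp => hc ?_⟩
  have himg : T.symm '' (p ⁻¹' {M * c + N}) = q ⁻¹' {c} := by
    ext z
    simp only [Set.mem_image, Set.mem_preimage, Set.mem_singleton_iff]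
    constructor
    · rintro ⟨w, hw, rfl⟩
      rw [h] at hw
      exact mul_left_cancel₀ hM (by linarith)
    · intro hz
      exact ⟨T z, by rw [h, AffineEquiv.symm_apply_apply, hz], by simp⟩
  rw [← himg]
  exact hp.image _ T.symm.continuous_of_finiteDimensional.continuousOn

/-- The hypotheses pass from `p` to `q` and the conclusion comes back, so any representative of the
class may be studied instead. -/
theorem classified (h : AffinelyEquivalent p q) (hq : Classified q) : Classified p :=
  fun hs hd => h.isNormalizable
    (hq (h.symm.isPlaneSubmersion hs) (h.symm.hasDisconnectedLevelSet hd))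

end AffinelyEquivalent

/-! ### Quartics by coefficients, and tameness -/

/-- The coefficients of a polynomial of degree at most four in two variables; `aij` is the
coefficient of `x ^ i * y ^ j`. -/
structure QuarticCoeffs where
  a40 : ℝ
  a31 : ℝ
  a22 : ℝ
  a13 : ℝ
  a04 : ℝ
  a30 : ℝ
  a21 : ℝ
  a12 : ℝ
  a03 : ℝ
  a20 : ℝ
  a11 : ℝ
  a02 : ℝ
  a10 : ℝ
  a01 : ℝ
  a00 : ℝ

namespace QuarticCoeffs

/-- The polynomial function with the given coefficients. -/
def eval (Q : QuarticCoeffs) (z : ℝ × ℝ) : ℝ :=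
  Q.a40 * z.1 ^ 4 + Q.a31 * (z.1 ^ 3 * z.2) + Q.a22 * (z.1 ^ 2 * z.2 ^ 2) +
    Q.a13 * (z.1 * z.2 ^ 3) + Q.a04 * z.2 ^ 4 + Q.a30 * z.1 ^ 3 + Q.a21 * (z.1 ^ 2 * z.2) +
    Q.a12 * (z.1 * z.2 ^ 2) + Q.a03 * z.2 ^ 3 + Q.a20 * z.1 ^ 2 + Q.a11 * (z.1 * z.2) +
    Q.a02 * z.2 ^ 2 + Q.a10 * z.1 + Q.a01 * z.2 + Q.a00

/-- The partial derivative in the first variable. -/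
def dx (Q : QuarticCoeffs) (x y : ℝ) : ℝ :=
  4 * Q.a40 * x ^ 3 + 3 * Q.a31 * x ^ 2 * y + 2 * Q.a22 * x * y ^ 2 + Q.a13 * y ^ 3 +
    3 * Q.a30 * x ^ 2 + 2 * Q.a21 * x * y + Q.a12 * y ^ 2 + 2 * Q.a20 * x + Q.a11 * y + Q.a10

/-- The partial derivative in the second variable. -/
def dy (Q : QuarticCoeffs) (x y : ℝ) : ℝ :=
  Q.a31 * x ^ 3 + 2 * Q.a22 * x ^ 2 * y + 3 * Q.a13 * x * y ^ 2 + 4 * Q.a04 * y ^ 3 +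
    Q.a21 * x ^ 2 + 2 * Q.a12 * x * y + 3 * Q.a03 * y ^ 2 + Q.a11 * x + 2 * Q.a02 * y + Q.a01

variable {Q : QuarticCoeffs}

theorem hasFDerivAt_eval (Q : QuarticCoeffs) (z : ℝ × ℝ) :
    HasFDerivAt Q.eval (Q.dx z.1 z.2 • ContinuousLinearMap.fst ℝ ℝ ℝ +
      Q.dy z.1 z.2 • ContinuousLinearMap.snd ℝ ℝ ℝ) z := by
  have hx : HasFDerivAt (fun z : ℝ × ℝ => z.1) (ContinuousLinearMap.fst ℝ ℝ ℝ) z :=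
    hasFDerivAt_fst
  have hy : HasFDerivAt (fun z : ℝ × ℝ => z.2) (ContinuousLinearMap.snd ℝ ℝ ℝ) z :=
    hasFDerivAt_snd
  have h := (((((((((((((((hx.pow 4).const_mul Q.a40).add
    (((hx.pow 3).mul hy).const_mul Q.a31)).add
    (((hx.pow 2).mul (hy.pow 2)).const_mul Q.a22)).add
    ((hx.mul (hy.pow 3)).const_mul Q.a13)).add
    ((hy.pow 4).const_mul Q.a04)).add
    ((hx.pow 3).const_mul Q.a30)).add
    (((hx.pow 2).mul hy).const_mul Q.a21)).add
    ((hx.mul (hy.pow 2)).const_mul Q.a12)).add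
    ((hy.pow 3).const_mul Q.a03)).add
    ((hx.pow 2).const_mul Q.a20)).add
    ((hx.mul hy).const_mul Q.a11)).add
    ((hy.pow 2).const_mul Q.a02)).add
    (hx.const_mul Q.a10)).add
    (hy.const_mul Q.a01)).add_const Q.a00
  refine HasFDerivAt.congr_fderiv h ?_
  ext <;> simp [dx, dy] <;> ring

theorem contDiff_dx (Q : QuarticCoeffs) {n : WithTop ℕ∞} :
    ContDiff ℝ n fun z : ℝ × ℝ => Q.dx z.1 z.2 := by
  unfold dx
  fun_prop

theorem contDiff_dy (Q : QuarticCoeffs) {n : WithTop ℕ∞} :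
    ContDiff ℝ n fun z : ℝ × ℝ => Q.dy z.1 z.2 := by
  unfold dy
  fun_prop

theorem fderiv_eval (Q : QuarticCoeffs) (z w : ℝ × ℝ) :
    fderiv ℝ Q.eval z w = Q.dx z.1 z.2 * w.1 + Q.dy z.1 z.2 * w.2 := by
  rw [(Q.hasFDerivAt_eval z).fderiv]
  simp

/-- A submersion has no critical point. -/
theorem dy_ne_zero (hQ : IsPlaneSubmersion Q.eval) {x y : ℝ} (hx : Q.dx x y = 0) :
    Q.dy x y ≠ 0 := by
  intro hy
  obtain ⟨w, hw⟩ := hQ.2 (x, y) 1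
  rw [fderiv_eval] at hw
  simp [hx, hy] at hw

/-- The gradient stays away from zero near infinity. -/
def Tame (Q : QuarticCoeffs) : Prop :=
  ∃ δ > 0, ∃ R, ∀ x y, |Q.dx x y| ≤ δ → |Q.dy x y| ≤ δ → |x| ≤ R ∧ |y| ≤ R

/-- Outside a compact ball tameness gives the bound; inside it, the continuous and nowhere zero
gradient has a positive minimum. -/
theorem Tame.exists_le_norm_gradient (hQ : Q.Tame) (hs : IsPlaneSubmersion Q.eval) :
    ∃ δ > 0, ∀ z : ℝ × ℝ, δ ≤ ‖(Q.dx z.1 z.2, Q.dy z.1 z.2)‖ := by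
  obtain ⟨δ, hδ, R, h⟩ := hQ
  have hc : Continuous fun z : ℝ × ℝ => ‖(Q.dx z.1 z.2, Q.dy z.1 z.2)‖ :=
    ((Q.contDiff_dx (n := 0)).continuous.prodMk (Q.contDiff_dy (n := 0)).continuous).norm
  have hne : (Metric.closedBall (0 : ℝ × ℝ) (max R 0)).Nonempty := ⟨0, by simp⟩
  obtain ⟨z₀, -, hz₀⟩ := (isCompact_closedBall (0 : ℝ × ℝ) (max R 0)).exists_isMinOn hne
    hc.continuousOn
  have hpos : 0 < ‖(Q.dx z₀.1 z₀.2, Q.dy z₀.1 z₀.2)‖ := by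
    rw [norm_pos_iff]
    intro h0
    exact dy_ne_zero hs (congrArg Prod.fst h0) (congrArg Prod.snd h0)
  refine ⟨min δ _, lt_min hδ hpos, fun z => ?_⟩
  by_cases hz : |Q.dx z.1 z.2| ≤ δ ∧ |Q.dy z.1 z.2| ≤ δ
  · obtain ⟨h1, h2⟩ := h _ _ hz.1 hz.2
    refine (min_le_right _ _).trans (hz₀ ?_)
    rw [mem_closedBall_zero_iff, Prod.norm_def]
    exact max_le (h1.trans (le_max_left _ _)) (h2.trans (le_max_left _ _))
  · refine (min_le_left _ _).trans ?_
    by_contra hlt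
    rw [not_le, Prod.norm_def, max_lt_iff] at hlt
    exact hz ⟨hlt.1.le, hlt.2.le⟩

/-- If the gradient is bounded away from zero then the level sets are connected. -/
theorem isPreconnected_level_of_le_norm_gradient {δ : ℝ} (hδ : 0 < δ)
    (h : ∀ z : ℝ × ℝ, δ ≤ ‖(Q.dx z.1 z.2, Q.dy z.1 z.2)‖) (c : ℝ) :
    IsPreconnected (Q.eval ⁻¹' {c}) := by
  set g : ℝ × ℝ → ℝ × ℝ := fun z => (Q.dx z.1 z.2, Q.dy z.1 z.2) with hg
  set n : ℝ × ℝ → ℝ := fun z => Q.dx z.1 z.2 ^ 2 + Q.dy z.1 z.2 ^ 2 with hn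
  have hgn : ∀ z, ‖g z‖ ^ 2 ≤ n z := by
    intro z
    have h1 := sq_nonneg (Q.dx z.1 z.2)
    have h2 := sq_nonneg (Q.dy z.1 z.2)
    rw [hg, Prod.norm_def]
    rcases max_choice ‖Q.dx z.1 z.2‖ ‖Q.dy z.1 z.2‖ with h' | h' <;> simp only [h'] <;>
      rw [Real.norm_eq_abs, sq_abs] <;> simp only [hn] <;> linarith
  have hgpos : ∀ z, 0 < ‖g z‖ := fun z => hδ.trans_le (h z)
  have hnpos : ∀ z, 0 < n z := fun z => (pow_pos (hgpos z) 2).trans_le (hgn z)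
  refine isPreconnected_level_of_bounded_lift (v := fun z => (n z)⁻¹ • g z) (L := δ⁻¹)
    (fun z => (Q.hasFDerivAt_eval z).differentiableAt) ?_ (fun z => ?_) (fun z => ?_) c
  · exact (((Q.contDiff_dx.pow 2).add (Q.contDiff_dy.pow 2)).inv fun z => (hnpos z).ne').smul
      (Q.contDiff_dx.prodMk Q.contDiff_dy)
  -- The norm on the plane is the sup norm, at most the Euclidean one, so ‖g‖/n ≤ 1/‖g‖ ≤ 1/δ.
  · rw [norm_smul, norm_inv, Real.norm_of_nonneg (hnpos z).le, inv_mul_le_iff₀ (hnpos z),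
      ← div_eq_mul_inv, le_div_iff₀ hδ]
    nlinarith [hgn z, h z, hgpos z]
  · rw [fderiv_eval]
    have := (hnpos z).ne'
    simp only [Prod.smul_mk, smul_eq_mul, hg]
    field_simp
    rfl

/-- The level sets of a tame submersion are connected. -/
theorem Tame.not_hasDisconnectedLevelSet (hQ : Q.Tame) (hs : IsPlaneSubmersion Q.eval) :
    ¬ HasDisconnectedLevelSet Q.eval := by
  rintro ⟨c, hc⟩
  obtain ⟨δ, hδ, h⟩ := hQ.exists_le_norm_gradient hs
  exact hc (isPreconnected_level_of_le_norm_gradient hδ h c)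

theorem Tame.classified (hQ : Q.Tame) : Classified Q.eval :=
  fun hs hd => absurd hd (hQ.not_hasDisconnectedLevelSet hs)

/-- A gradient whose principal part for the weights `(a, b)` vanishes only at the origin is
tame. -/
theorem tame_of_weights {a b m n : ℕ} {H K : ℝ → ℝ → ℝ → ℝ}
    (hH : Continuous fun w : ℝ × ℝ × ℝ => H w.1 w.2.1 w.2.2)
    (hK : Continuous fun w : ℝ × ℝ × ℝ => K w.1 w.2.1 w.2.2)
    (ha : a ≠ 0) (hb : b ≠ 0)
    (hdx : ∀ t, t ≠ 0 → ∀ x y, Q.dx (t ^ a * x) (t ^ b * y) = t ^ m * H t⁻¹ x y)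
    (hdy : ∀ t, t ≠ 0 → ∀ x y, Q.dy (t ^ a * x) (t ^ b * y) = t ^ n * K t⁻¹ x y)
    (h0 : ∀ x y, H 0 x y = 0 → K 0 x y = 0 → x = 0 ∧ y = 0) : Q.Tame := by
  have hcont : Continuous fun w : ℝ × (ℝ × ℝ) =>
      max |H w.1 w.2.1 w.2.2| |K w.1 w.2.1 w.2.2| := hH.abs.max hK.abs
  have hS : IsCompact (Metric.sphere (0 : ℝ × ℝ) 1) := isCompact_sphere _ _
  obtain ⟨z₀, hz₀, hmin⟩ := hS.exists_isMinOn ⟨(1, 0), by simp [Prod.norm_def]⟩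
    (hcont.comp
      (continuous_const.prodMk continuous_id : Continuous fun z => ((0 : ℝ), z))).continuousOn
  set μ : ℝ := max |H 0 z₀.1 z₀.2| |K 0 z₀.1 z₀.2| with hμ
  have hμ0 : 0 < μ := by
    by_contra hle
    rw [not_lt, hμ, max_le_iff, abs_nonpos_iff, abs_nonpos_iff] at hle
    obtain ⟨h1, h2⟩ := h0 _ _ hle.1 hle.2
    have : z₀ = 0 := Prod.ext h1 h2
    simp [this] at hz₀
  -- The lower bound on the principal parts at `s = 0` persists, halved, for all small `s`,
  -- uniformly over the compact sphere.
  obtain ⟨U, V, hU, -, hU0, hV, hUV⟩ := generalized_tube_lemma (s := {(0 : ℝ)}) isCompact_singleton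
    hS (n := {w | μ / 2 < max |H w.1 w.2.1 w.2.2| |K w.1 w.2.1 w.2.2|})
    (isOpen_lt continuous_const hcont) (by
      rintro ⟨s, z⟩ ⟨hs, hz⟩
      obtain rfl : s = 0 := hs
      exact (half_lt_self hμ0).trans_le (hmin hz))
  obtain ⟨ε, hε, hεU⟩ := Metric.isOpen_iff.mp hU 0 (hU0 rfl)
  -- For `t > R`, the bound `2 / ε` puts `t⁻¹` in `U`, and the bound `1` makes the factors `t ^ m`
  -- and `t ^ n` at least one.
  set R : ℝ := max 1 (2 / ε) with hR
  have hR1 : 1 ≤ R := le_max_left _ _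
  refine ⟨μ / 2, by positivity, R ^ a + R ^ b, fun x y hx hy => ?_⟩
  by_contra hcon
  -- The weighted size of `(x, y)`: dividing by `t ^ a` and `t ^ b` lands on the unit sphere.
  set t : ℝ := max (|x| ^ ((a : ℝ)⁻¹)) (|y| ^ ((b : ℝ)⁻¹)) with ht
  have hpa : ∀ {u : ℝ} {k : ℕ}, k ≠ 0 → (|u| ^ ((k : ℝ)⁻¹)) ^ k = |u| := fun {u k} hk =>
    Real.rpow_inv_natCast_pow (abs_nonneg u) hk
  have hxt : |x| ≤ t ^ a := by
    conv_lhs => rw [← hpa (u := x) ha]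
    exact pow_le_pow_left₀ (by positivity) (le_max_left _ _) _
  have hyt : |y| ≤ t ^ b := by
    conv_lhs => rw [← hpa (u := y) hb]
    exact pow_le_pow_left₀ (by positivity) (le_max_right _ _) _
  have hRt : R < t := by
    by_contra hle
    have ht0 : 0 ≤ t := le_max_of_le_left (by positivity)
    have h1 : t ^ a ≤ R ^ a := pow_le_pow_left₀ ht0 (not_lt.mp hle) _
    have h2 : t ^ b ≤ R ^ b := pow_le_pow_left₀ ht0 (not_lt.mp hle) _
    have h3 : 0 ≤ R ^ a := by positivity
    have h4 : 0 ≤ R ^ b := by positivity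
    exact hcon ⟨by linarith, by linarith⟩
  have ht1 : 1 < t := hR1.trans_lt hRt
  have ht0 : 0 < t := one_pos.trans ht1
  have hmem : (x / t ^ a, y / t ^ b) ∈ Metric.sphere (0 : ℝ × ℝ) 1 := by
    rw [mem_sphere_zero_iff_norm, Prod.norm_def]
    have e1 : ‖x / t ^ a‖ = |x| / t ^ a := by
      rw [norm_div, Real.norm_eq_abs, Real.norm_of_nonneg (by positivity)]
    have e2 : ‖y / t ^ b‖ = |y| / t ^ b := by
      rw [norm_div, Real.norm_eq_abs, Real.norm_of_nonneg (by positivity)]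
    simp only [e1, e2]
    refine le_antisymm (max_le ((div_le_one (by positivity)).mpr hxt)
      ((div_le_one (by positivity)).mpr hyt)) ?_
    rcases max_choice (|x| ^ ((a : ℝ)⁻¹)) (|y| ^ ((b : ℝ)⁻¹)) with h' | h'
    · refine le_max_of_le_left ((one_le_div (by positivity)).mpr ?_)
      rw [ht, h', hpa ha]
    · refine le_max_of_le_right ((one_le_div (by positivity)).mpr ?_)
      rw [ht, h', hpa hb]
  have htU : t⁻¹ ∈ U := by
    refine hεU ?_
    rw [Metric.mem_ball, Real.dist_0_eq_abs, abs_of_pos (inv_pos.mpr ht0)]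
    have : 2 / ε < t := (le_max_right _ _).trans_lt hRt
    rw [div_lt_iff₀ hε] at this
    rw [inv_lt_iff_one_lt_mul₀ ht0]
    nlinarith
  have hbig : μ / 2 < max |H t⁻¹ (x / t ^ a) (y / t ^ b)| |K t⁻¹ (x / t ^ a) (y / t ^ b)| :=
    hUV (Set.mk_mem_prod htU (hV hmem))
  have hxa : t ^ a * (x / t ^ a) = x := mul_div_cancel₀ x (by positivity)
  have hyb : t ^ b * (y / t ^ b) = y := mul_div_cancel₀ y (by positivity)
  have e1 := hdx t ht0.ne' (x / t ^ a) (y / t ^ b)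
  have e2 := hdy t ht0.ne' (x / t ^ a) (y / t ^ b)
  rw [hxa, hyb] at e1 e2
  rw [e1, abs_mul, abs_of_nonneg (by positivity)] at hx
  rw [e2, abs_mul, abs_of_nonneg (by positivity)] at hy
  have hm : 1 ≤ t ^ m := one_le_pow₀ ht1.le
  have hn : 1 ≤ t ^ n := one_le_pow₀ ht1.le
  rcases lt_max_iff.mp hbig with h' | h'
  · nlinarith [abs_nonneg (H t⁻¹ (x / t ^ a) (y / t ^ b))]
  · nlinarith [abs_nonneg (K t⁻¹ (x / t ^ a) (y / t ^ b))]

/-- If the gradient of the leading form vanishes only at the origin then the polynomial is tame. -/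
theorem tame_of_leadingForm
    (h : ∀ x y, 4 * Q.a40 * x ^ 3 + 3 * Q.a31 * x ^ 2 * y + 2 * Q.a22 * x * y ^ 2 +
        Q.a13 * y ^ 3 = 0 →
      Q.a31 * x ^ 3 + 2 * Q.a22 * x ^ 2 * y + 3 * Q.a13 * x * y ^ 2 + 4 * Q.a04 * y ^ 3 = 0 →
      x = 0 ∧ y = 0) : Q.Tame := by
  refine tame_of_weights (a := 1) (b := 1) (m := 3) (n := 3)
    (H := fun s x y =>
      4 * Q.a40 * x ^ 3 + 3 * Q.a31 * x ^ 2 * y + 2 * Q.a22 * x * y ^ 2 + Q.a13 * y ^ 3 + 3 *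
      Q.a30 * s * x ^ 2 + 2 * Q.a21 * s * x * y + Q.a12 * s * y ^ 2 + 2 * Q.a20 * s ^ 2 * x +
      Q.a11 * s ^ 2 * y + Q.a10 * s ^ 3)
    (K := fun s x y =>
      Q.a31 * x ^ 3 + 2 * Q.a22 * x ^ 2 * y + 3 * Q.a13 * x * y ^ 2 + 4 * Q.a04 * y ^ 3 + Q.a21
      * s * x ^ 2 + 2 * Q.a12 * s * x * y + 3 * Q.a03 * s * y ^ 2 + Q.a11 * s ^ 2 * x + 2 *
      Q.a02 * s ^ 2 * y + Q.a01 * s ^ 3)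
    (by fun_prop) (by fun_prop) (by norm_num) (by norm_num) (fun t ht x y => ?_)
    (fun t ht x y => ?_) (fun x y hH hK => h x y ?_ ?_)
  · simp only [dx]
    field_simp
  · simp only [dy]
    field_simp
  · linear_combination hH
  · linear_combination hK

/-! ### Weighted homogeneous principal parts -/

/-- With weights (4, 3) both y⁴ and x³ have degree 12, so the partial derivatives have degrees 8 and
9; every other monomial has smaller degree and contributes a positive power of `s`. The next four
lemmas follow the same pattern, with weights that balance the two monomials in their names. -/
theorem tame_of_y4_x3 (h40 : Q.a40 = 0) (h31 : Q.a31 = 0) (h22 : Q.a22 = 0) (h13 : Q.a13 = 0)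
    (h04 : Q.a04 ≠ 0) (h30 : Q.a30 ≠ 0) :
    Q.Tame := by
  refine tame_of_weights (a := 4) (b := 3) (m := 8) (n := 9)
    (H := fun s x y =>
      3 * Q.a30 * x ^ 2 + 2 * Q.a21 * s * x * y + Q.a12 * s ^ 2 * y ^ 2 + 2 * Q.a20 * s ^ 4 * x
      + Q.a11 * s ^ 5 * y + Q.a10 * s ^ 8)
    (K := fun s x y =>
      4 * Q.a04 * y ^ 3 + Q.a21 * s * x ^ 2 + 2 * Q.a12 * s ^ 2 * x * y + 3 * Q.a03 * s ^ 3 * y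
      ^ 2 + Q.a11 * s ^ 5 * x + 2 * Q.a02 * s ^ 6 * y + Q.a01 * s ^ 9)
    (by fun_prop) (by fun_prop) (by norm_num) (by norm_num) (fun t ht x y => ?_)
    (fun t ht x y => ?_) (fun x y hH hK => ?_)
  · simp only [dx, h40, h31, h22, h13]
    field_simp
    ring
  · simp only [dy, h31, h22, h13]
    field_simp
    ring
  · have hH' : Q.a30 * x ^ 2 = 0 := by linear_combination (1 / 3) * hH
    have hK' : Q.a04 * y ^ 3 = 0 := by linear_combination (1 / 4) * hK
    simp_all

theorem tame_of_y4_x2y (h40 : Q.a40 = 0) (h31 : Q.a31 = 0) (h22 : Q.a22 = 0) (h13 : Q.a13 = 0)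
    (h30 : Q.a30 = 0) (h04 : Q.a04 ≠ 0) (h21 : Q.a21 ≠ 0) :
    Q.Tame := by
  refine tame_of_weights (a := 3) (b := 2) (m := 5) (n := 6)
    (H := fun s x y =>
      2 * Q.a21 * x * y + Q.a12 * s * y ^ 2 + 2 * Q.a20 * s ^ 2 * x + Q.a11 * s ^ 3 * y + Q.a10
      * s ^ 5)
    (K := fun s x y =>
      4 * Q.a04 * y ^ 3 + Q.a21 * x ^ 2 + 2 * Q.a12 * s * x * y + 3 * Q.a03 * s ^ 2 * y ^ 2 +
      Q.a11 * s ^ 3 * x + 2 * Q.a02 * s ^ 4 * y + Q.a01 * s ^ 6)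
    (by fun_prop) (by fun_prop) (by norm_num) (by norm_num) (fun t ht x y => ?_)
    (fun t ht x y => ?_) (fun x y hH hK => ?_)
  · simp only [dx, h40, h31, h22, h13, h30]
    field_simp
    ring
  · simp only [dy, h31, h22, h13]
    field_simp
    ring
  · have hH' : Q.a21 * (x * y) = 0 := by linear_combination (1 / 2) * hH
    have hK' : 4 * Q.a04 * y ^ 3 + Q.a21 * x ^ 2 = 0 := by linear_combination hK
    have hxy : x = 0 ∨ y = 0 := by simpa [h21] using hH'
    rcases hxy with rfl | rfl <;> simp_all

theorem tame_of_xy3_x3 (h40 : Q.a40 = 0) (h31 : Q.a31 = 0) (h22 : Q.a22 = 0) (h13 : Q.a13 ≠ 0)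
    (h30 : Q.a30 ≠ 0) :
    Q.Tame := by
  refine tame_of_weights (a := 3) (b := 2) (m := 6) (n := 7)
    (H := fun s x y =>
      Q.a13 * y ^ 3 + 3 * Q.a30 * x ^ 2 + 2 * Q.a21 * s * x * y + Q.a12 * s ^ 2 * y ^ 2 + 2 *
      Q.a20 * s ^ 3 * x + Q.a11 * s ^ 4 * y + Q.a10 * s ^ 6)
    (K := fun s x y =>
      3 * Q.a13 * x * y ^ 2 + 4 * Q.a04 * s * y ^ 3 + Q.a21 * s * x ^ 2 + 2 * Q.a12 * s ^ 2 * x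
      * y + 3 * Q.a03 * s ^ 3 * y ^ 2 + Q.a11 * s ^ 4 * x + 2 * Q.a02 * s ^ 5 * y + Q.a01 * s ^
      7)
    (by fun_prop) (by fun_prop) (by norm_num) (by norm_num) (fun t ht x y => ?_)
    (fun t ht x y => ?_) (fun x y hH hK => ?_)
  · simp only [dx, h40, h31, h22]
    field_simp
    ring
  · simp only [dy, h31, h22]
    field_simp
    ring
  · have hH' : Q.a13 * y ^ 3 + 3 * Q.a30 * x ^ 2 = 0 := by linear_combination hH
    have hK' : Q.a13 * (x * y ^ 2) = 0 := by linear_combination (1 / 3) * hK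
    have hxy : x = 0 ∨ y = 0 := by simpa [h13] using hK'
    rcases hxy with rfl | rfl <;> simp_all

theorem tame_of_xy3_x2y (h40 : Q.a40 = 0) (h31 : Q.a31 = 0) (h22 : Q.a22 = 0) (h30 : Q.a30 = 0)
    (h13 : Q.a13 ≠ 0) (h21 : Q.a21 ≠ 0) :
    Q.Tame := by
  refine tame_of_weights (a := 2) (b := 1) (m := 3) (n := 4)
    (H := fun s x y =>
      Q.a13 * y ^ 3 + 2 * Q.a21 * x * y + Q.a12 * s * y ^ 2 + 2 * Q.a20 * s * x + Q.a11 * s ^ 2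
      * y + Q.a10 * s ^ 3)
    (K := fun s x y =>
      3 * Q.a13 * x * y ^ 2 + 4 * Q.a04 * s * y ^ 3 + Q.a21 * x ^ 2 + 2 * Q.a12 * s * x * y + 3
      * Q.a03 * s ^ 2 * y ^ 2 + Q.a11 * s ^ 2 * x + 2 * Q.a02 * s ^ 3 * y + Q.a01 * s ^ 4)
    (by fun_prop) (by fun_prop) (by norm_num) (by norm_num) (fun t ht x y => ?_)
    (fun t ht x y => ?_) (fun x y hH hK => ?_)
  · simp only [dx, h40, h31, h22, h30]
    field_simp
    ring
  · simp only [dy, h31, h22]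
    field_simp
    ring
  · have hH' : y * (Q.a13 * y ^ 2 + 2 * Q.a21 * x) = 0 := by linear_combination hH
    have hK' : x * (3 * Q.a13 * y ^ 2 + Q.a21 * x) = 0 := by linear_combination hK
    rcases mul_eq_zero.mp hH' with rfl | hy
    · simp_all
    -- On the parabola `a13 * y ^ 2 = -2 * a21 * x` the second equation becomes `-5 * a21 * x ^ 2 =
    -- 0`.
    · have hx : Q.a21 * x ^ 2 = 0 := by linear_combination (-1 / 5) * hK' + (3 / 5) * x * hy
      obtain rfl : x = 0 := by simpa [h21] using hx
      simp_all

theorem tame_of_xy3_x2 (h40 : Q.a40 = 0) (h31 : Q.a31 = 0) (h22 : Q.a22 = 0) (h30 : Q.a30 = 0)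
    (h21 : Q.a21 = 0) (h13 : Q.a13 ≠ 0) (h20 : Q.a20 ≠ 0) :
    Q.Tame := by
  refine tame_of_weights (a := 3) (b := 1) (m := 3) (n := 5)
    (H := fun s x y =>
      Q.a13 * y ^ 3 + Q.a12 * s * y ^ 2 + 2 * Q.a20 * x + Q.a11 * s ^ 2 * y + Q.a10 * s ^ 3)
    (K := fun s x y =>
      3 * Q.a13 * x * y ^ 2 + 4 * Q.a04 * s ^ 2 * y ^ 3 + 2 * Q.a12 * s * x * y + 3 * Q.a03 * s
      ^ 3 * y ^ 2 + Q.a11 * s ^ 2 * x + 2 * Q.a02 * s ^ 4 * y + Q.a01 * s ^ 5)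
    (by fun_prop) (by fun_prop) (by norm_num) (by norm_num) (fun t ht x y => ?_)
    (fun t ht x y => ?_) (fun x y hH hK => ?_)
  · simp only [dx, h40, h31, h22, h30, h21]
    field_simp
    ring
  · simp only [dy, h31, h22, h21]
    field_simp
    ring
  · have hH' : Q.a13 * y ^ 3 + 2 * Q.a20 * x = 0 := by linear_combination hH
    have hK' : Q.a13 * (x * y ^ 2) = 0 := by linear_combination (1 / 3) * hK
    have hxy : x = 0 ∨ y = 0 := by simpa [h13] using hK'
    rcases hxy with rfl | rfl <;> simp_all

end QuarticCoeffs

/-! ### Real cubics: growth, roots, lower bounds -/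

open Polynomial in
theorem exists_bound_of_cubic_le {a b c : ℝ} (h : a ≠ 0 ∨ b ≠ 0 ∨ c ≠ 0) (d M : ℝ) :
    ∃ R, ∀ y : ℝ, |a * y ^ 3 + b * y ^ 2 + c * y + d| ≤ M → |y| ≤ R := by
  set P : ℝ[X] := C a * X ^ 3 + C b * X ^ 2 + C c * X + C d with hP
  have hdeg : 0 < P.degree := by
    by_contra hle
    have hC := eq_C_of_degree_le_zero (not_lt.mp hle)
    have h3 : P.coeff 3 = 0 := by rw [hC]; simp
    have h2 : P.coeff 2 = 0 := by rw [hC]; simp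
    have h1 : P.coeff 1 = 0 := by rw [hC]; simp
    simp [hP, coeff_C, coeff_X_pow] at h3 h2 h1
    simp_all
  have ht := P.tendsto_norm_atTop hdeg (z := fun y : ℝ => y) (l := Filter.cocompact ℝ)
    tendsto_norm_cocompact_atTop
  have hev := ht.eventually_gt_atTop M
  rw [← Metric.cobounded_eq_cocompact, ← comap_norm_atTop, Filter.eventually_comap] at hev
  obtain ⟨R, hR⟩ := Filter.eventually_atTop.mp hev
  refine ⟨R, fun y hy => ?_⟩
  by_contra hlt
  have := hR |y| (not_le.mp hlt).le y rfl
  simp only [hP, eval_add, eval_mul, eval_pow, eval_C, eval_X, Real.norm_eq_abs] at this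
  linarith

theorem exists_root_of_cubic {a : ℝ} (ha : a ≠ 0) (b c d : ℝ) :
    ∃ y : ℝ, a * y ^ 3 + b * y ^ 2 + c * y + d = 0 := by
  -- At `±T` the leading term dominates the rest. Multiplying the cubic by `a` makes its signs there
  -- independent of the sign of `a`.
  set T : ℝ := 1 + (|b| + |c| + |d|) / |a| with hT
  have ha' : 0 < |a| := abs_pos.mpr ha
  have hT1 : 1 ≤ T := le_add_of_nonneg_right (by positivity)
  have hTa : |b| + |c| + |d| ≤ |a| * T := by
    rw [hT, mul_add, mul_div_cancel₀ _ ha'.ne']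
    linarith
  have hlow : ∀ t : ℝ, |t| = T → |a * (b * t ^ 2 + c * t + d)| ≤ a ^ 2 * T ^ 3 := by
    intro t ht
    have h1 : |b * t ^ 2 + c * t + d| ≤ (|b| + |c| + |d|) * T ^ 2 := by
      refine (abs_add_three _ _ _).trans ?_
      rw [abs_mul, abs_mul, abs_pow, ht]
      nlinarith [mul_nonneg (abs_nonneg c) (by nlinarith : 0 ≤ T ^ 2 - T),
        mul_nonneg (abs_nonneg d) (by nlinarith : 0 ≤ T ^ 2 - 1)]
    rw [abs_mul, ← sq_abs a]
    calc _ ≤ |a| * (|a| * T * T ^ 2) := by gcongr; exact h1.trans (by gcongr)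
      _ = _ := by ring
  have hcont : Continuous fun y : ℝ => a * (a * y ^ 3 + b * y ^ 2 + c * y + d) := by fun_prop
  have hpos := abs_le.mp (hlow T (abs_of_pos (by linarith)))
  have hneg := abs_le.mp (hlow (-T) (by rw [abs_neg, abs_of_pos (by linarith)]))
  obtain ⟨y, hy⟩ := mem_range_of_exists_le_of_exists_ge (c := (0 : ℝ)) hcont
    ⟨-T, by linarith [hneg.2]⟩ ⟨T, by linarith [hpos.1]⟩
  exact ⟨y, (mul_eq_zero.mp hy).resolve_left ha⟩

/-- A polynomial of degree at most three without zeros is bounded away from zero. -/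
theorem exists_le_abs_cubic {a b c d : ℝ} (h : ∀ y : ℝ, a * y ^ 3 + b * y ^ 2 + c * y + d ≠ 0) :
    ∃ δ > 0, ∀ y : ℝ, δ ≤ |a * y ^ 3 + b * y ^ 2 + c * y + d| := by
  by_cases hc : a ≠ 0 ∨ b ≠ 0 ∨ c ≠ 0
  · obtain ⟨R, hR⟩ := exists_bound_of_cubic_le hc d 1
    have hcont : Continuous fun y : ℝ => |a * y ^ 3 + b * y ^ 2 + c * y + d| := by fun_prop
    obtain ⟨y₀, -, hy₀⟩ := (isCompact_closedBall (0 : ℝ) (max R 0)).exists_isMinOn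
      ⟨0, by simp⟩ hcont.continuousOn
    refine ⟨min 1 _, lt_min one_pos (abs_pos.mpr (h y₀)), fun y => ?_⟩
    by_cases hy : |a * y ^ 3 + b * y ^ 2 + c * y + d| ≤ 1
    · refine (min_le_right _ _).trans (hy₀ ?_)
      rw [mem_closedBall_zero_iff, Real.norm_eq_abs]
      exact (hR y hy).trans (le_max_left _ _)
    · exact (min_le_left _ _).trans (not_le.mp hy).le
  · push Not at hc
    obtain ⟨rfl, rfl, rfl⟩ := hc
    exact ⟨|d|, abs_pos.mpr (by simpa using h 0), fun y => by simp⟩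

/-! ### Estimates where both partial derivatives of x²y² + … are small -/

theorem le_of_sq_le_linear {A B C t : ℝ} (hA : 0 < A) (hB : 0 ≤ B) (hC : 0 ≤ C)
    (h : A * t ^ 2 ≤ B * t + C) : t ≤ 1 + (B + C) / A := by
  have hdiv : 0 ≤ (B + C) / A := by positivity
  rcases le_total t 1 with h1 | h1
  · linarith
  · have : t ≤ (B + C) / A := by
      rw [le_div_iff₀ hA]
      nlinarith
    linarith

/-- If `|2 y² + 3 a x|` is not too small then bounds for the two partial derivatives bound `y`. -/
theorem exists_bound_snd {ε d g : ℝ} (hr : ε ≠ 0 ∨ d ≠ 0 ∨ g ≠ 0) (a e f h k : ℝ) :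
    ∃ Y, 0 ≤ Y ∧ ∀ x y : ℝ, y ^ 2 ≤ |2 * y ^ 2 + 3 * a * x| →
      |x * (2 * y ^ 2 + 3 * a * x + 2 * e) + f * y + h| ≤ 1 →
      |2 * x ^ 2 * y + f * x + (4 * ε * y ^ 3 + 3 * d * y ^ 2 + 2 * g * y + k)| ≤ 1 → |y| ≤ Y := by
  set C : ℝ := 2 * (1 + |f| + |h|) with hC
  have hr' : 4 * ε ≠ 0 ∨ 3 * d ≠ 0 ∨ 2 * g ≠ 0 := by simpa using hr
  obtain ⟨R, hR⟩ := exists_bound_of_cubic_le hr' k (1 + 2 * C ^ 2 + |f| * C)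
  -- Beyond `1 + 4 * |e|` the bracket multiplying x is at least y²/2, so small ∂ₓ bounds |xy|, and
  -- hence |x|, by `C`. Then small ∂ᵧ bounds the cubic in y, which is nonconstant by `hr`.
  refine ⟨max R (1 + 4 * |e|), le_max_of_le_right (by positivity), fun x y hw hF hG => ?_⟩
  by_contra hlt
  rw [not_le, max_lt_iff] at hlt
  obtain ⟨hRy, hey⟩ := hlt
  have he := abs_nonneg e
  have hy1 : 1 ≤ |y| := by linarith
  have hy2 : 4 * |e| ≤ y ^ 2 := by rw [← sq_abs y]; nlinarith
  set w := 2 * y ^ 2 + 3 * a * x + 2 * e with hwdef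
  have hw2 : y ^ 2 ≤ 2 * |w| := by
    have h1 : |2 * y ^ 2 + 3 * a * x| ≤ |w| + |2 * e| := by
      have : 2 * y ^ 2 + 3 * a * x = w - 2 * e := by rw [hwdef]; ring
      rw [this]
      exact abs_sub _ _
    rw [abs_mul, abs_two] at h1
    linarith
  have hxw : |x| * |w| ≤ 1 + |f| * |y| + |h| := by
    have h1 : x * w = (x * w + f * y + h) - (f * y + h) := by ring
    rw [← abs_mul, h1]
    calc _ ≤ |x * w + f * y + h| + |f * y + h| := abs_sub _ _
      _ ≤ 1 + (|f * y| + |h|) := add_le_add hF (abs_add_le _ _)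
      _ = _ := by rw [abs_mul]; ring
  have hx0 := abs_nonneg x
  have hxy : |x| * |y| ≤ C := by
    have h1 : |x| * |y| ^ 2 ≤ C * |y| := by
      rw [sq_abs]
      have : |x| * y ^ 2 ≤ |x| * (2 * |w|) := by gcongr
      nlinarith [abs_nonneg f, abs_nonneg h]
    have : (|x| * |y|) * |y| ≤ C * |y| := by linarith
    exact le_of_mul_le_mul_right this (by linarith)
  have hxC : |x| ≤ C := by nlinarith
  refine absurd (hR y ?_) (not_le.mpr hRy)
  have h1 : 4 * ε * y ^ 3 + 3 * d * y ^ 2 + 2 * g * y + k =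
      (2 * x ^ 2 * y + f * x + (4 * ε * y ^ 3 + 3 * d * y ^ 2 + 2 * g * y + k)) -
        (2 * (x * (x * y)) + f * x) := by ring
  rw [h1]
  calc _ ≤ _ := abs_sub _ _
    _ ≤ 1 + (|2 * (x * (x * y))| + |f * x|) := add_le_add hG (abs_add_le _ _)
    _ = 1 + 2 * (|x| * (|x| * |y|)) + |f| * |x| := by simp only [abs_mul, abs_two]; ring
    _ ≤ 1 + 2 * (C * C) + |f| * C := by gcongr
    _ = _ := by ring

/-- In this region y² is at most linear in |x|. If |y| ≥ 1, dividing the second derivative by y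
bounds 2x² by a linear function of |x|; if |y| ≤ 1, the term 3ax² of the first derivative plays that
role. -/
theorem exists_bound_fst_of_sq_le {a : ℝ} (ha : a ≠ 0) (ε d e f g h k : ℝ) :
    ∃ X, 0 ≤ X ∧ ∀ x y : ℝ, y ^ 2 ≤ 3 * |a| * |x| →
      |x * (2 * y ^ 2 + 3 * a * x + 2 * e) + f * y + h| ≤ 1 →
      |2 * x ^ 2 * y + f * x + (4 * ε * y ^ 3 + 3 * d * y ^ 2 + 2 * g * y + k)| ≤ 1 → |x| ≤ X := by
  have ha' : 0 < |a| := abs_pos.mpr ha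
  set B : ℝ := |f| + 12 * |ε| * |a| + 9 * |d| * |a| with hB
  set C : ℝ := 1 + |k| + 2 * |g| with hC
  have hB0 : 0 ≤ B := by positivity
  have hC0 : 0 ≤ C := by positivity
  refine ⟨max (1 + (B + C) / 2) (1 + ((2 + 2 * |e|) + (1 + |f| + |h|)) / (3 * |a|)),
    le_max_of_le_left (by positivity), fun x y hxy hF hG => ?_⟩
  have hx0 := abs_nonneg x
  rcases le_total 1 |y| with hy | hy
  · refine le_max_of_le_left (le_of_sq_le_linear two_pos hB0 hC0 ?_)
    have h1 : |y| * |2 * x ^ 2 + 4 * ε * y ^ 2 + 3 * d * y + 2 * g| ≤ 1 + |f| * |x| + |k| := by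
      rw [← abs_mul]
      have : y * (2 * x ^ 2 + 4 * ε * y ^ 2 + 3 * d * y + 2 * g) =
        (2 * x ^ 2 * y + f * x + (4 * ε * y ^ 3 + 3 * d * y ^ 2 + 2 * g * y + k)) -
          (f * x + k) := by ring
      rw [this]
      calc _ ≤ _ := abs_sub _ _
        _ ≤ 1 + (|f * x| + |k|) := add_le_add hG (abs_add_le _ _)
        _ = _ := by rw [abs_mul]; ring
    have h2 : |2 * x ^ 2 + 4 * ε * y ^ 2 + 3 * d * y + 2 * g| ≤ 1 + |f| * |x| + |k| := by
      refine le_trans ?_ h1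
      exact le_mul_of_one_le_left (abs_nonneg _) hy
    have h3 : 2 * |x| ^ 2 ≤ |2 * x ^ 2 + 4 * ε * y ^ 2 + 3 * d * y + 2 * g| +
        (4 * |ε| * y ^ 2 + 3 * |d| * |y| + 2 * |g|) := by
      have e1 : |4 * ε * y ^ 2 + 3 * d * y + 2 * g| ≤
          4 * |ε| * y ^ 2 + 3 * |d| * |y| + 2 * |g| := by
        calc _ ≤ |4 * ε * y ^ 2| + |3 * d * y| + |2 * g| := abs_add_three _ _ _
          _ = _ := by simp [abs_mul]
      have e2 := neg_abs_le (4 * ε * y ^ 2 + 3 * d * y + 2 * g)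
      have e3 := le_abs_self (2 * x ^ 2 + 4 * ε * y ^ 2 + 3 * d * y + 2 * g)
      have e4 := le_abs_self (4 * ε * y ^ 2 + 3 * d * y + 2 * g)
      rw [sq_abs]
      linarith
    have h4 : |y| ≤ 3 * |a| * |x| := by
      refine le_trans ?_ hxy
      rw [← sq_abs y]
      nlinarith
    have h5 : 4 * |ε| * y ^ 2 ≤ 4 * |ε| * (3 * |a| * |x|) := by gcongr
    have h6 : 3 * |d| * |y| ≤ 3 * |d| * (3 * |a| * |x|) := by gcongr
    rw [hB, hC]
    linarith
  · refine le_max_of_le_right (le_of_sq_le_linear (by positivity) (by positivity) (by positivity)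
      ?_)
    have hy2 : y ^ 2 ≤ 1 := by rw [← sq_abs y]; nlinarith [abs_nonneg y]
    have e1 : |3 * a * x ^ 2| ≤ |x * (2 * y ^ 2 + 3 * a * x + 2 * e) + f * y + h| +
        (|2 * x * y ^ 2| + |2 * e * x| + |f * y| + |h|) := by
      have : 3 * a * x ^ 2 = (x * (2 * y ^ 2 + 3 * a * x + 2 * e) + f * y + h) -
        (2 * x * y ^ 2 + 2 * e * x + f * y + h) := by ring
      rw [this]
      refine (abs_sub _ _).trans (add_le_add le_rfl ?_)
      exact (abs_add_le _ _).trans (add_le_add (abs_add_three _ _ _) le_rfl)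
    have e2 : |3 * a * x ^ 2| = 3 * |a| * |x| ^ 2 := by simp [abs_mul]
    have e3 : |2 * x * y ^ 2| ≤ 2 * |x| := by
      rw [abs_mul, abs_mul, abs_two, abs_of_nonneg (sq_nonneg y)]
      nlinarith
    have e4 : |2 * e * x| = 2 * |e| * |x| := by simp [abs_mul]
    have e5 : |f * y| ≤ |f| := by
      rw [abs_mul]
      exact mul_le_of_le_one_right (abs_nonneg f) hy
    linarith

/-- For large |x| the first inequality forces y² to be close to -e, in particular 2y² ≥ |e|.
Multiplying the second expression by y then makes |e|x² at most linear in |x|. Here `ρ` stands for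
the part depending on y alone. -/
theorem exists_bound_fst_of_ne_zero {e : ℝ} (he : e ≠ 0) (f h : ℝ) {Y M : ℝ} (hY : 0 ≤ Y)
    (hM : 0 ≤ M) :
    ∃ X, ∀ x y ρ : ℝ, |y| ≤ Y → |ρ| ≤ M → |x * (2 * y ^ 2 + 2 * e) + f * y + h| ≤ 1 →
      |2 * x ^ 2 * y + f * x + ρ| ≤ 1 → |x| ≤ X := by
  have he' : 0 < |e| := abs_pos.mpr he
  set C : ℝ := 1 + |f| * Y + |h| with hC
  have hC0 : 0 ≤ C := by positivity
  refine ⟨max (C / |e|) (1 + (|f| * Y + Y * (1 + M)) / |e|), fun x y ρ hy hρ hF hG => ?_⟩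
  by_contra hlt
  rw [not_le, max_lt_iff, div_lt_iff₀ he'] at hlt
  obtain ⟨h1, h2⟩ := hlt
  refine h2.not_ge (le_of_sq_le_linear he' (by positivity) (by positivity) ?_)
  have h3 : |x| * |2 * y ^ 2 + 2 * e| ≤ C := by
    rw [← abs_mul]
    have : x * (2 * y ^ 2 + 2 * e) = (x * (2 * y ^ 2 + 2 * e) + f * y + h) - (f * y + h) := by ring
    rw [this]
    calc _ ≤ _ := abs_sub _ _
      _ ≤ 1 + (|f * y| + |h|) := add_le_add hF (abs_add_le _ _)
      _ = 1 + |f| * |y| + |h| := by rw [abs_mul]; ring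
      _ ≤ C := by rw [hC]; gcongr
  have hx : 0 < |x| := by
    by_contra hx
    have : |x| = 0 := le_antisymm (not_lt.mp hx) (abs_nonneg x)
    rw [this] at h1
    linarith
  have h4 : |2 * y ^ 2 + 2 * e| ≤ |e| := by
    by_contra h'
    have := mul_lt_mul_of_pos_left (not_le.mp h') hx
    linarith
  have h5 : |e| ≤ 2 * y ^ 2 := by
    rcases abs_cases e with ⟨h', h''⟩ | ⟨h', h''⟩ <;> rw [h'] at h4 ⊢ <;>
      have := abs_le.mp h4 <;> nlinarith [sq_nonneg y]
  have h6 : 2 * x ^ 2 * y ^ 2 ≤ Y * (1 + |f| * |x| + M) := by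
    have : 2 * x ^ 2 * y ^ 2 = y * ((2 * x ^ 2 * y + f * x + ρ) - (f * x + ρ)) := by ring
    rw [this]
    refine (le_abs_self _).trans ?_
    rw [abs_mul]
    refine mul_le_mul hy ?_ (abs_nonneg _) hY
    calc _ ≤ _ := abs_sub _ _
      _ ≤ 1 + (|f * x| + |ρ|) := add_le_add hG (abs_add_le _ _)
      _ ≤ _ := by rw [abs_mul]; linarith
  have h7 : |e| * |x| ^ 2 ≤ 2 * x ^ 2 * y ^ 2 := by
    rw [sq_abs]
    nlinarith [sq_nonneg x]
  linarith

/-- The first inequality bounds |x|y², so for large |x| the term fy is at most |h|/4 and 2|x|y² must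
be at least |h|/2 to balance h. Multiplied by |x|, this beats the bound |fy||x| + O(1) obtained from
y times the second expression. -/
theorem exists_bound_fst_of_linear_ne_zero {h : ℝ} (hh : h ≠ 0) (f : ℝ) {Y M : ℝ} (hY : 0 ≤ Y)
    (hM : 0 ≤ M) :
    ∃ X, ∀ x y ρ : ℝ, |y| ≤ Y → |ρ| ≤ M → |2 * x * y ^ 2 + f * y + h| ≤ |h| / 4 →
      |2 * x ^ 2 * y + f * x + ρ| ≤ 1 → |x| ≤ X := by
  have hh' : 0 < |h| := abs_pos.mpr hh
  set C : ℝ := 2 * |h| + |f| * Y with hC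
  have hC0 : 0 ≤ C := by positivity
  refine ⟨max (16 * C * f ^ 2 / h ^ 2) (4 * Y * (1 + M) / |h|), fun x y ρ hy hρ hF hG => ?_⟩
  by_contra hlt
  rw [not_le, max_lt_iff, div_lt_iff₀ (by positivity), div_lt_iff₀ hh'] at hlt
  obtain ⟨h1, h2⟩ := hlt
  have hx : 0 < |x| := by
    by_contra hx
    have : |x| = 0 := le_antisymm (not_lt.mp hx) (abs_nonneg x)
    rw [this, zero_mul] at h2
    exact absurd h2 (not_lt.mpr (by positivity))
  have hxy : 2 * |x| * y ^ 2 ≤ C := by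
    have e1 : 2 * |x| * y ^ 2 = |2 * x * y ^ 2| := by simp [abs_mul]
    have : 2 * x * y ^ 2 = (2 * x * y ^ 2 + f * y + h) - (f * y + h) := by ring
    rw [e1, this]
    calc _ ≤ _ := abs_sub _ _
      _ ≤ |h| / 4 + (|f * y| + |h|) := add_le_add hF (abs_add_le _ _)
      _ = |h| / 4 + |f| * |y| + |h| := by rw [abs_mul]; ring
      _ ≤ |h| / 4 + |f| * Y + |h| := by gcongr
      _ ≤ C := by rw [hC]; linarith
  have hfy : |f * y| ≤ |h| / 4 := by
    refine abs_le_of_sq_le_sq ?_ (by positivity)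
    rw [div_pow, sq_abs]
    have e1 : |x| * (16 * (f * y) ^ 2) ≤ |x| * h ^ 2 := by
      have : |x| * (16 * (f * y) ^ 2) = 8 * f ^ 2 * (2 * |x| * y ^ 2) := by ring
      rw [this]
      have : 8 * f ^ 2 * (2 * |x| * y ^ 2) ≤ 8 * f ^ 2 * C := by gcongr
      nlinarith [mul_nonneg hC0 (sq_nonneg f)]
    have := le_of_mul_le_mul_left e1 hx
    linarith
  have hlow : |h| / 2 ≤ 2 * |x| * y ^ 2 := by
    have e1 : 2 * |x| * y ^ 2 = |2 * x * y ^ 2| := by simp [abs_mul]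
    have e2 : |h| ≤ |2 * x * y ^ 2 + f * y + h| + (|2 * x * y ^ 2| + |f * y|) := by
      have : h = (2 * x * y ^ 2 + f * y + h) - (2 * x * y ^ 2 + f * y) := by ring
      conv_lhs => rw [this]
      exact (abs_sub _ _).trans (add_le_add le_rfl (abs_add_le _ _))
    rw [e1]
    linarith
  have h6 : 2 * x ^ 2 * y ^ 2 ≤ |f * y| * |x| + Y * (1 + M) := by
    have e0 : 2 * x ^ 2 * y ^ 2 = y * ((2 * x ^ 2 * y + f * x + ρ) - ρ) - f * y * x := by ring
    rw [e0]
    refine (le_abs_self _).trans ((abs_sub _ _).trans ?_)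
    rw [abs_mul (f * y), abs_mul y, add_comm]
    refine add_le_add le_rfl (mul_le_mul hy ?_ (abs_nonneg _) hY)
    exact (abs_sub _ _).trans (add_le_add hG hρ)
  have h7 : |x| * (|h| / 2) ≤ 2 * x ^ 2 * y ^ 2 := by
    rw [← sq_abs x]
    nlinarith
  nlinarith

namespace QuarticCoeffs

variable {Q : QuarticCoeffs}

/-! ### Polynomials with a simple dependence on the first variable -/

/-- Without a zero of the coefficient of x, each level is the graph of a continuous function of y.
-/
theorem exists_root_of_linear (h40 : Q.a40 = 0) (h31 : Q.a31 = 0) (h22 : Q.a22 = 0)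
    (h30 : Q.a30 = 0) (h21 : Q.a21 = 0) (h20 : Q.a20 = 0) (hd : HasDisconnectedLevelSet Q.eval) :
    ∃ y, Q.a13 * y ^ 3 + Q.a12 * y ^ 2 + Q.a11 * y + Q.a10 = 0 := by
  by_contra! hne
  obtain ⟨c, hc⟩ := hd
  refine hc ?_
  set A : ℝ → ℝ := fun y => Q.a13 * y ^ 3 + Q.a12 * y ^ 2 + Q.a11 * y + Q.a10 with hA
  set r : ℝ → ℝ := fun y =>
    Q.a04 * y ^ 4 + Q.a03 * y ^ 3 + Q.a02 * y ^ 2 + Q.a01 * y + Q.a00 with hr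
  have heval : ∀ x y, Q.eval (x, y) = x * A y + r y := by
    intro x y
    simp only [eval, h40, h31, h22, h30, h21, h20, hA, hr]
    ring
  have hlevel : Q.eval ⁻¹' {c} = Set.range fun y => ((c - r y) / A y, y) := by
    ext ⟨x, y⟩
    simp only [Set.mem_preimage, Set.mem_singleton_iff, Set.mem_range, heval, Prod.mk.injEq]
    constructor
    · intro h
      refine ⟨y, ?_, rfl⟩
      rw [div_eq_iff (hne y)]
      linarith
    · rintro ⟨y, rfl, rfl⟩
      rw [div_mul_cancel₀ _ (hne y)]
      ring
  rw [hlevel]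
  refine isPreconnected_range (Continuous.prodMk (Continuous.div ?_ ?_ hne) continuous_id)
  · simp only [hr]
    fun_prop
  · simp only [hA]
    fun_prop

/-- Along the horizontal line through a root, ∂ₓ vanishes and ∂ᵧ is affine in x; a nonzero slope
would produce a critical point. -/
theorem deriv_eq_zero_of_root_of_linear (h40 : Q.a40 = 0) (h31 : Q.a31 = 0) (h22 : Q.a22 = 0)
    (h30 : Q.a30 = 0) (h21 : Q.a21 = 0) (h20 : Q.a20 = 0) (hs : IsPlaneSubmersion Q.eval) {y : ℝ}
    (hy : Q.a13 * y ^ 3 + Q.a12 * y ^ 2 + Q.a11 * y + Q.a10 = 0) :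
    3 * Q.a13 * y ^ 2 + 2 * Q.a12 * y + Q.a11 = 0 := by
  by_contra hne
  refine dy_ne_zero hs (y := y) (x := -(4 * Q.a04 * y ^ 3 + 3 * Q.a03 * y ^ 2 + 2 * Q.a02 * y +
    Q.a01) / (3 * Q.a13 * y ^ 2 + 2 * Q.a12 * y + Q.a11)) ?_ ?_
  · simp only [dx, h40, h31, h22, h30, h21, h20]
    linear_combination hy
  · set x := -(4 * Q.a04 * y ^ 3 + 3 * Q.a03 * y ^ 2 + 2 * Q.a02 * y + Q.a01) /
      (3 * Q.a13 * y ^ 2 + 2 * Q.a12 * y + Q.a11) with hx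
    have := div_mul_cancel₀ (-(4 * Q.a04 * y ^ 3 + 3 * Q.a03 * y ^ 2 + 2 * Q.a02 * y + Q.a01)) hne
    rw [← hx] at this
    simp only [dy, h31, h22, h21]
    linear_combination this

/-- Completing the square in the first variable: a submersion which is quadratic in `x`, with
constant coefficient of `x ^ 2`, has connected level sets. -/
theorem not_hasDisconnectedLevelSet_of_square (h40 : Q.a40 = 0) (h31 : Q.a31 = 0)
    (h22 : Q.a22 = 0) (h13 : Q.a13 = 0) (h30 : Q.a30 = 0) (h21 : Q.a21 = 0) (h20 : Q.a20 ≠ 0)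
    (hs : IsPlaneSubmersion Q.eval) : ¬ HasDisconnectedLevelSet Q.eval := by
  rintro ⟨c, hc⟩
  refine hc ?_
  set s : ℝ → ℝ := fun y => (Q.a12 * y ^ 2 + Q.a11 * y + Q.a10) / (2 * Q.a20) with hsdef
  let q : QuarticCoeffs :=
    { a40 := 0, a31 := 0, a22 := 0, a13 := 0, a04 := Q.a04 - Q.a12 ^ 2 / (4 * Q.a20)
      a30 := 0, a21 := 0, a12 := 0, a03 := Q.a03 - Q.a12 * Q.a11 / (2 * Q.a20)
      a20 := Q.a20, a11 := 0, a02 := Q.a02 - (2 * Q.a12 * Q.a10 + Q.a11 ^ 2) / (4 * Q.a20)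
      a10 := 0, a01 := Q.a01 - Q.a11 * Q.a10 / (2 * Q.a20)
      a00 := Q.a00 - Q.a10 ^ 2 / (4 * Q.a20) }
  have heval : ∀ u y, Q.eval (u - s y, y) = q.eval (u, y) := by
    intro u y
    simp only [eval, h40, h31, h22, h13, h30, h21, q, hsdef]
    field_simp
    ring
  have hqdy : ∀ x y, q.dy x y = 4 * q.a04 * y ^ 3 + 3 * q.a03 * y ^ 2 + 2 * q.a02 * y + q.a01 := by
    intro x y
    simp only [dy, q]
    ring
  -- This one-variable derivative is ∂ᵧ of the original polynomial along the curve where ∂ₓ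
  -- vanishes.
  have hne : ∀ y, 4 * q.a04 * y ^ 3 + 3 * q.a03 * y ^ 2 + 2 * q.a02 * y + q.a01 ≠ 0 := by
    intro y
    have hdx : Q.dx (-s y) y = 0 := by
      simp only [dx, h40, h31, h22, h13, h30, h21, hsdef]
      field_simp
      ring
    have hdy : Q.dy (-s y) y =
        4 * q.a04 * y ^ 3 + 3 * q.a03 * y ^ 2 + 2 * q.a02 * y + q.a01 := by
      simp only [dy, h31, h22, h13, h21, hsdef, q]
      field_simp
      ring
    rw [← hdy]
    exact dy_ne_zero hs hdx
  -- The gradient bound is needed only for `q`; the shear relating the two polynomials is not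
  -- affine, but its continuity is enough to transport connectedness.
  obtain ⟨δ, hδ, h⟩ := exists_le_abs_cubic hne
  have hq := isPreconnected_level_of_le_norm_gradient (Q := q) hδ (fun z => by
    refine le_trans ?_ (le_max_right _ _)
    rw [hqdy]
    exact h z.2) c
  have himg : Q.eval ⁻¹' {c} = (fun z : ℝ × ℝ => (z.1 - s z.2, z.2)) '' (q.eval ⁻¹' {c}) := by
    ext ⟨x, y⟩
    simp only [Set.mem_preimage, Set.mem_singleton_iff, Set.mem_image, Prod.exists, Prod.mk.injEq]
    constructor
    · intro hx
      refine ⟨x + s y, y, ?_, by ring, rfl⟩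
      rw [← heval, add_sub_cancel_right]
      exact hx
    · rintro ⟨u, y, hu, rfl, rfl⟩
      rw [heval]
      exact hu
  rw [himg]
  refine hq.image _ (Continuous.continuousOn ?_)
  simp only [hsdef]
  fun_prop

/-- After tameness and the square case are removed, the coefficient of x is `a12 * (y - y₀) ^ 2`; if
`a12` vanished, a root of the cubic r' would give a critical point. -/
theorem classified_of_y4 (h40 : Q.a40 = 0) (h31 : Q.a31 = 0) (h22 : Q.a22 = 0) (h13 : Q.a13 = 0)
    (h04 : Q.a04 ≠ 0) : Classified Q.eval := by
  by_cases h30 : Q.a30 = 0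
  swap
  · exact (tame_of_y4_x3 h40 h31 h22 h13 h04 h30).classified
  by_cases h21 : Q.a21 = 0
  swap
  · exact (tame_of_y4_x2y h40 h31 h22 h13 h30 h04 h21).classified
  intro hs hd
  by_cases h20 : Q.a20 = 0
  swap
  · exact absurd hd (not_hasDisconnectedLevelSet_of_square h40 h31 h22 h13 h30 h21 h20 hs)
  obtain ⟨y₀, hy₀⟩ := exists_root_of_linear h40 h31 h22 h30 h21 h20 hd
  have hy₁ := deriv_eq_zero_of_root_of_linear h40 h31 h22 h30 h21 h20 hs hy₀
  rw [h13] at hy₀ hy₁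
  have h11 : Q.a11 = -2 * Q.a12 * y₀ := by linear_combination hy₁
  have h10 : Q.a10 = Q.a12 * y₀ ^ 2 := by linear_combination hy₀ - y₀ * h11
  have h12 : Q.a12 ≠ 0 := by
    intro h12
    rw [h12] at h11 h10
    obtain ⟨y, hy⟩ := exists_root_of_cubic (mul_ne_zero four_ne_zero h04) (3 * Q.a03) (2 * Q.a02)
      Q.a01
    refine dy_ne_zero hs (x := 0) (y := y) ?_ ?_
    · simp [dx, h13, h12, h11, h10]
    · simp only [dy]
      linear_combination hy
  -- `D`, `G`, `k` are the cubic, quadratic and linear Taylor coefficients at `y₀` of the part free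
  -- of x. Below, `b` cancels the y³ term, `s` cancels the y² term, and `l` is chosen so that y⁴ and
  -- y get equal coefficients.
  set D := 4 * Q.a04 * y₀ + Q.a03 with hD
  set G := 6 * Q.a04 * y₀ ^ 2 + 3 * Q.a03 * y₀ + Q.a02 with hG
  set k := 4 * Q.a04 * y₀ ^ 3 + 3 * Q.a03 * y₀ ^ 2 + 2 * Q.a02 * y₀ + Q.a01 with hk
  have hk0 : k ≠ 0 := by
    have h := dy_ne_zero hs (x := 0) (y := y₀)
      (by simp only [dx, h40, h31, h22, h13, h30, h21, h20]; linear_combination hy₀)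
    intro hk0
    refine h ?_
    simp only [dy]
    linear_combination hk0
  obtain ⟨l, hl⟩ := exists_root_of_cubic h04 0 0 (-k)
  have hl0 : l ≠ 0 := by
    rintro rfl
    exact hk0 (by linear_combination -hl)
  have hα : Q.a12 * (k / (Q.a12 * l)) * l = k := by field_simp
  have hβ : Q.a12 * (-(D * l) / Q.a12) = -(D * l) := by field_simp
  have hσ : Q.a12 * (-G / Q.a12) = -G := by field_simp
  refine Or.inl (AffinelyEquivalent.of_substitution (M := k * l) (N := Q.eval (0, y₀))
    (a := k / (Q.a12 * l)) (b := -(D * l) / Q.a12) (c := 0) (d := l) (s := -G / Q.a12) (t := y₀)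
    (mul_ne_zero hk0 hl0) ?_ fun x y => ?_)
  · rw [mul_zero, sub_zero]
    exact mul_ne_zero (div_ne_zero hk0 (mul_ne_zero h12 hl0)) hl0
  · generalize k / (Q.a12 * l) = α at *
    generalize -(D * l) / Q.a12 = β at *
    generalize -G / Q.a12 = σ at *
    simp only [eval, h40, h31, h22, h13, h30, h21, h20, h11, h10]
    linear_combination x * y ^ 2 * l * hα + y ^ 3 * l ^ 2 * hβ + y ^ 2 * l ^ 2 * hσ +
      l * y ^ 4 * hl + l ^ 3 * y ^ 3 * hD + l ^ 2 * y ^ 2 * hG + l * y * hk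

theorem classified_of_xy3 (h40 : Q.a40 = 0) (h31 : Q.a31 = 0) (h22 : Q.a22 = 0) (h13 : Q.a13 ≠ 0) :
    Classified Q.eval := by
  by_cases h30 : Q.a30 = 0
  swap
  · exact (tame_of_xy3_x3 h40 h31 h22 h13 h30).classified
  by_cases h21 : Q.a21 = 0
  swap
  · exact (tame_of_xy3_x2y h40 h31 h22 h30 h13 h21).classified
  by_cases h20 : Q.a20 = 0
  swap
  · exact (tame_of_xy3_x2 h40 h31 h22 h30 h21 h13 h20).classified
  intro hs hd
  obtain ⟨y₀, hy₀⟩ := exists_root_of_linear h40 h31 h22 h30 h21 h20 hd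
  have hy₁ := deriv_eq_zero_of_root_of_linear h40 h31 h22 h30 h21 h20 hs hy₀
  have h12 : Q.a12 = -3 * Q.a13 * y₀ := by
    -- The third root, from the sum of the roots. It must also be multiple, and the derivative there
    -- is `a13 * (y₁ - y₀) ^ 2`, so the root is triple.
    set y₁ := -Q.a12 / Q.a13 - 2 * y₀ with hdef
    have h12 : Q.a12 = -Q.a13 * (y₁ + 2 * y₀) := by
      rw [hdef]
      field_simp
      ring
    have h11 : Q.a11 = -(3 * Q.a13 * y₀ ^ 2 + 2 * Q.a12 * y₀) := by linear_combination hy₁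
    have h10 : Q.a10 = -(Q.a13 * y₀ ^ 3 + Q.a12 * y₀ ^ 2 + Q.a11 * y₀) := by
      linear_combination hy₀
    have h := deriv_eq_zero_of_root_of_linear h40 h31 h22 h30 h21 h20 hs (y := y₁)
      (by rw [h10, h11, h12]; ring)
    have h' : Q.a13 * (y₁ - y₀) ^ 2 = 0 := by
      rw [h11, h12] at h
      linear_combination h
    have h'' : y₁ = y₀ := by
      have := (mul_eq_zero.mp h').resolve_left h13
      linarith [pow_eq_zero_iff (two_ne_zero) |>.mp this]
    rw [h12, h'']
    ring
  have h11 : Q.a11 = 3 * Q.a13 * y₀ ^ 2 := by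
    linear_combination hy₁ - 2 * y₀ * h12
  have h10 : Q.a10 = -(Q.a13 * y₀ ^ 3) := by
    linear_combination hy₀ - y₀ * h11 - y₀ ^ 2 * h12
  set D := 4 * Q.a04 * y₀ + Q.a03 with hD
  set G := 6 * Q.a04 * y₀ ^ 2 + 3 * Q.a03 * y₀ + Q.a02 with hG
  set k := 4 * Q.a04 * y₀ ^ 3 + 3 * Q.a03 * y₀ ^ 2 + 2 * Q.a02 * y₀ + Q.a01 with hk
  have hk0 : k ≠ 0 := by
    have h := dy_ne_zero hs (x := 0) (y := y₀)
      (by simp only [dx, h40, h31, h22, h30, h21, h20]; linear_combination hy₀)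
    intro hk0
    refine h ?_
    simp only [dy]
    linear_combination hk0
  -- The shear and the translation in x remove y⁴ and y³, so only y² survives besides y; scaling y
  -- normalizes its coefficient to 0 or 1.
  obtain ⟨l, a, hl0, ha, hl⟩ : ∃ l a : ℝ, l ≠ 0 ∧ (a = 0 ∨ a = 1) ∧ G * l = a * k := by
    by_cases hG0 : G = 0
    · exact ⟨1, 0, one_ne_zero, Or.inl rfl, by rw [hG0]; ring⟩
    · exact ⟨k / G, 1, div_ne_zero hk0 hG0, Or.inr rfl, by field_simp⟩
  have hα : Q.a13 * (k / (Q.a13 * l ^ 2)) * l ^ 2 = k := by field_simp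
  have hβ : Q.a13 * (-(Q.a04 * l) / Q.a13) = -(Q.a04 * l) := by field_simp
  have hσ : Q.a13 * (-D / Q.a13) = -D := by field_simp
  refine Or.inr (Or.inl ⟨a, ha, AffinelyEquivalent.of_substitution (M := k * l)
    (N := Q.eval (0, y₀)) (a := k / (Q.a13 * l ^ 2)) (b := -(Q.a04 * l) / Q.a13) (c := 0) (d := l)
    (s := -D / Q.a13) (t := y₀) (mul_ne_zero hk0 hl0) ?_ fun x y => ?_⟩)
  · rw [mul_zero, sub_zero]
    exact mul_ne_zero (div_ne_zero hk0 (mul_ne_zero h13 (pow_ne_zero 2 hl0))) hl0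
  · generalize k / (Q.a13 * l ^ 2) = α at *
    generalize -(Q.a04 * l) / Q.a13 = β at *
    generalize -D / Q.a13 = σ at *
    simp only [eval, h40, h31, h22, h30, h21, h20, h12, h11, h10]
    linear_combination x * y ^ 3 * l * hα + y ^ 4 * l ^ 3 * hβ + y ^ 3 * l ^ 3 * hσ +
      l * y ^ 2 * hl + l ^ 3 * y ^ 3 * hD + l ^ 2 * y ^ 2 * hG + l * y * hk

/-! ### Leading form `x ^ 2 * y ^ 2 + ε * y ^ 4` -/

/-- The polynomial `x²y² + εy⁴ + ax³ + dy³ + ex² + fxy + gy² + hx + ky + m`. -/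
def biquadratic (ε a d e f g h k m : ℝ) : QuarticCoeffs :=
  { a40 := 0, a31 := 0, a22 := 1, a13 := 0, a04 := ε, a30 := a, a21 := 0, a12 := 0, a03 := d
    a20 := e, a11 := f, a02 := g, a10 := h, a01 := k, a00 := m }

section Biquadratic

variable {ε a d e f g h k m : ℝ}

theorem dx_biquadratic (x y : ℝ) : (biquadratic ε a d e f g h k m).dx x y =
    x * (2 * y ^ 2 + 3 * a * x + 2 * e) + f * y + h := by
  simp only [dx, biquadratic]
  ring

theorem dy_biquadratic (x y : ℝ) : (biquadratic ε a d e f g h k m).dy x y =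
    2 * x ^ 2 * y + f * x + (4 * ε * y ^ 3 + 3 * d * y ^ 2 + 2 * g * y + k) := by
  simp only [dy, biquadratic]
  ring

theorem eval_biquadratic (x y : ℝ) : (biquadratic ε a d e f g h k m).eval (x, y) =
    x ^ 2 * y ^ 2 + ε * y ^ 4 + a * x ^ 3 + d * y ^ 3 + e * x ^ 2 + f * (x * y) + g * y ^ 2 +
      h * x + k * y + m := by
  simp only [eval, biquadratic]
  ring

theorem biquadratic_comp_swap (a d e f g h k m : ℝ) :
    AffinelyEquivalent (biquadratic 0 a d e f g h k m).eval
      (biquadratic 0 d a g f e k h m).eval := by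
  convert AffinelyEquivalent.comp_swap (biquadratic 0 a d e f g h k m).eval using 1
  ext ⟨x, y⟩
  simp only [eval_biquadratic]
  ring

/-- The plane is cut along y² = 3|a||x|. Outside this region the term 3ax cannot cancel 2y², so y is
bounded first; inside it, x is bounded first. Each bound then controls the other variable. -/
theorem tame_biquadratic (ha : a ≠ 0) (hr : ε ≠ 0 ∨ d ≠ 0) :
    (biquadratic ε a d e f g h k m).Tame := by
  obtain ⟨Y, hY, hY'⟩ := exists_bound_snd (g := g)
    (show ε ≠ 0 ∨ d ≠ 0 ∨ g ≠ 0 by tauto) a e f h k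
  obtain ⟨X, hX, hX'⟩ := exists_bound_fst_of_sq_le ha ε d e f g h k
  have ha' : 0 < 3 * |a| := mul_pos three_pos (abs_pos.mpr ha)
  refine ⟨1, one_pos, X + (1 + 3 * |a| * X) + Y + Y ^ 2 / (3 * |a|), fun x y hF hG => ?_⟩
  rw [dx_biquadratic] at hF
  rw [dy_biquadratic] at hG
  have h1 : 0 ≤ 3 * |a| * X := by positivity
  have h2 : 0 ≤ Y ^ 2 / (3 * |a|) := by positivity
  by_cases hxy : y ^ 2 ≤ 3 * |a| * |x|
  · have hx := hX' x y hxy hF hG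
    have hy : |y| ≤ 1 + 3 * |a| * X := by
      have : |y| ^ 2 ≤ 3 * |a| * X := by
        rw [sq_abs]
        exact hxy.trans (by gcongr)
      nlinarith [sq_nonneg (|y| - 1)]
    exact ⟨by linarith, by linarith⟩
  · have hw : y ^ 2 ≤ |2 * y ^ 2 + 3 * a * x| := by
      have e1 := neg_abs_le (3 * a * x)
      have e2 : |3 * a * x| = 3 * |a| * |x| := by simp [abs_mul]
      exact le_trans (by linarith) (le_abs_self _)
    have hy := hY' x y hw hF hG
    have hx : |x| ≤ Y ^ 2 / (3 * |a|) := by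
      rw [le_div_iff₀ ha']
      have : y ^ 2 ≤ Y ^ 2 := sq_le_sq' (abs_le.mp hy).1 (abs_le.mp hy).2
      linarith
    exact ⟨by linarith, by linarith⟩

theorem exists_bound_cubic_on (a b c d Y : ℝ) :
    ∃ M, 0 ≤ M ∧ ∀ y : ℝ, |y| ≤ Y → |a * y ^ 3 + b * y ^ 2 + c * y + d| ≤ M := by
  obtain ⟨M, hM⟩ := (isCompact_closedBall (0 : ℝ) Y).exists_bound_of_continuousOn
    (f := fun y : ℝ => a * y ^ 3 + b * y ^ 2 + c * y + d) (by fun_prop)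
  exact ⟨max M 0, le_max_right _ _, fun y hy =>
    (hM y (by simpa using hy)).trans (le_max_left _ _)⟩

/-- Without x³ the bound on y holds in the whole plane, and e ≠ 0 then bounds x. -/
theorem tame_biquadratic_of_sq (hr : ε ≠ 0 ∨ d ≠ 0 ∨ g ≠ 0) (he : e ≠ 0) :
    (biquadratic ε 0 d e f g h k m).Tame := by
  obtain ⟨Y, hY, hY'⟩ := exists_bound_snd hr 0 e f h k
  obtain ⟨M, hM, hM'⟩ := exists_bound_cubic_on (4 * ε) (3 * d) (2 * g) k Y
  obtain ⟨X, hX'⟩ := exists_bound_fst_of_ne_zero he f h hY hM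
  refine ⟨1, one_pos, max X Y, fun x y hF hG => ?_⟩
  rw [dx_biquadratic] at hF
  rw [dy_biquadratic] at hG
  have hy := hY' x y (by
    refine le_trans ?_ (le_abs_self _)
    nlinarith [sq_nonneg y]) hF hG
  refine ⟨le_max_of_le_left (hX' x y _ hy (hM' y hy) ?_ hG), le_max_of_le_right hy⟩
  convert hF using 2
  ring

theorem tame_biquadratic_of_linear (hr : ε ≠ 0 ∨ d ≠ 0 ∨ g ≠ 0) (hh : h ≠ 0) :
    (biquadratic ε 0 d 0 f g h k m).Tame := by
  obtain ⟨Y, hY, hY'⟩ := exists_bound_snd hr 0 0 f h k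
  obtain ⟨M, hM, hM'⟩ := exists_bound_cubic_on (4 * ε) (3 * d) (2 * g) k Y
  obtain ⟨X, hX'⟩ := exists_bound_fst_of_linear_ne_zero hh f hY hM
  have hh' : 0 < |h| := abs_pos.mpr hh
  refine ⟨min 1 (|h| / 4), by positivity, max X Y, fun x y hF hG => ?_⟩
  rw [dx_biquadratic] at hF
  rw [dy_biquadratic] at hG
  have hy := hY' x y (by
    refine le_trans ?_ (le_abs_self _)
    nlinarith [sq_nonneg y]) (hF.trans (min_le_left _ _)) (hG.trans (min_le_left _ _))
  refine ⟨le_max_of_le_left (hX' x y _ hy (hM' y hy) ?_ (hG.trans (min_le_left _ _))),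
    le_max_of_le_right hy⟩
  refine le_trans (le_of_eq ?_) (hF.trans (min_le_right _ _))
  congr 1
  ring

theorem tame_biquadratic_of_linear_of_linear (hh : h ≠ 0) (hk : k ≠ 0) :
    (biquadratic 0 0 0 0 f 0 h k m).Tame := by
  obtain ⟨X, hX⟩ := exists_bound_fst_of_linear_ne_zero hh f (Y := 1) (M := |k|) zero_le_one
    (abs_nonneg k)
  obtain ⟨Y, hY⟩ := exists_bound_fst_of_linear_ne_zero hk f (Y := 1) (M := |h|) zero_le_one
    (abs_nonneg h)
  have hh' : 0 < |h| := abs_pos.mpr hh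
  have hk' : 0 < |k| := abs_pos.mpr hk
  refine ⟨min 1 (min (|h| / 4) (|k| / 4)), by positivity,
    max 1 (max X (max Y (1 + |h| + |f|))), fun x y hF hG => ?_⟩
  have hF' : (biquadratic 0 0 0 0 f 0 h k m).dx x y = 2 * x * y ^ 2 + f * y + h := by
    rw [dx_biquadratic]
    ring
  have hG' : (biquadratic 0 0 0 0 f 0 h k m).dy x y = 2 * x ^ 2 * y + f * x + k := by
    rw [dy_biquadratic]
    ring
  rw [hF'] at hF
  rw [hG'] at hG
  have hF1 := hF.trans (min_le_left _ _)
  have hG1 := hG.trans (min_le_left _ _)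
  have hF4 := hF.trans ((min_le_right _ _).trans (min_le_left _ _))
  have hG4 := hG.trans ((min_le_right _ _).trans (min_le_right _ _))
  simp only [le_max_iff]
  rcases le_total |y| 1 with hy | hy
  · have := hX x y k hy le_rfl hF4 hG1
    exact ⟨Or.inr (Or.inl this), Or.inl hy⟩
  rcases le_total |x| 1 with hx | hx
  · have := hY y x h hx le_rfl
      (by rwa [mul_right_comm] at hG4) (by rwa [mul_right_comm] at hF1)
    exact ⟨Or.inl hx, Or.inr (Or.inr (Or.inl this))⟩
  -- Only the region |x|, |y| ≥ 1 is left. There a bound on the product bounds both factors.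
  have hxy : |x| * |y| ≤ 1 + |h| + |f| := by
    have h1 : |y| * |2 * (x * y) + f| ≤ 1 + |h| := by
      rw [← abs_mul]
      have : y * (2 * (x * y) + f) = (2 * x * y ^ 2 + f * y + h) - h := by ring
      rw [this]
      exact (abs_sub _ _).trans (add_le_add hF1 le_rfl)
    have h2 : |2 * (x * y) + f| ≤ 1 + |h| :=
      (le_mul_of_one_le_left (abs_nonneg _) hy).trans h1
    have h3 : 2 * (|x| * |y|) ≤ |2 * (x * y) + f| + |f| := by
      have : 2 * (|x| * |y|) = |2 * (x * y) + f - f| := by simp [abs_mul]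
      rw [this]
      exact abs_sub _ _
    nlinarith [abs_nonneg x, abs_nonneg y]
  exact ⟨Or.inr (Or.inr (Or.inr (by nlinarith))), Or.inr (Or.inr (Or.inr (by nlinarith)))⟩

/-- On a submersion without the terms `x³`, `x²` and `x`, the term `xy` is missing as well and the
linear term `y` is present. -/
theorem biquadratic_coeffs_of_isPlaneSubmersion
    (hs : IsPlaneSubmersion (biquadratic ε 0 d 0 f g 0 k m).eval) : f = 0 ∧ k ≠ 0 := by
  have hdx : ∀ x, (biquadratic ε 0 d 0 f g 0 k m).dx x 0 = 0 := by
    intro x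
    rw [dx_biquadratic]
    ring
  -- On the axis y = 0, where ∂ₓ vanishes, ∂ᵧ equals fx + k.
  have hf : f = 0 := by
    by_contra hf
    refine dy_ne_zero hs (hdx (-k / f)) ?_
    rw [dy_biquadratic]
    field_simp
    ring
  refine ⟨hf, fun hk => dy_ne_zero hs (hdx 0) ?_⟩
  rw [dy_biquadratic, hk]
  ring

/-- A real root of 3dy² + 2gy + k would be a critical point on x = 0, so g² < 3dk. Since the
normalized parameter has square g²/(dk), this is exactly the condition a² < 3. -/
theorem isNormalizable_biquadratic_of_cubic (hd : d ≠ 0)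
    (hs : IsPlaneSubmersion (biquadratic 0 0 d 0 0 g 0 k m).eval) :
    IsNormalizable (biquadratic 0 0 d 0 0 g 0 k m).eval := by
  obtain ⟨-, hk⟩ := biquadratic_coeffs_of_isPlaneSubmersion hs
  have hdisc : g ^ 2 < 3 * (d * k) := by
    by_contra hle
    have hsq := Real.sq_sqrt (sub_nonneg.mpr (not_lt.mp hle))
    set w := √(g ^ 2 - 3 * (d * k)) with hw
    refine dy_ne_zero hs (x := 0) (y := (-g + w) / (3 * d)) ?_ ?_
    · rw [dx_biquadratic]
      ring
    · rw [dy_biquadratic]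
      have hy : 3 * d * ((-g + w) / (3 * d)) = -g + w := by field_simp
      set y := (-g + w) / (3 * d)
      refine (mul_eq_zero.mp (?_ : 3 * d * _ = 0)).resolve_left (mul_ne_zero three_ne_zero hd)
      linear_combination (3 * d * y - g + w + 2 * g) * hy + hsq
  have hdk : 0 < d * k := by nlinarith [sq_nonneg g]
  -- `d * l ^ 2 = k` equalizes the coefficients of y³ and y. The sign of `l` is that of `k`, so that
  -- x can be rescaled by `√(k / l)`.
  obtain ⟨l, hl, hlk⟩ : ∃ l, d * l ^ 2 = k ∧ 0 < k * l := by
    have hkd : 0 < k / d := by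
      rw [← mul_div_mul_left k d hd]
      exact div_pos hdk (mul_self_pos.mpr hd)
    have hsq : d * √(k / d) ^ 2 = k := by
      rw [Real.sq_sqrt hkd.le]
      field_simp
    have hpos : 0 < √(k / d) := Real.sqrt_pos.mpr hkd
    rcases lt_or_gt_of_ne hk with hk' | hk'
    · exact ⟨-√(k / d), by rw [neg_sq, hsq], by nlinarith⟩
    · exact ⟨√(k / d), hsq, mul_pos hk' hpos⟩
  have hl0 : l ≠ 0 := by
    rintro rfl
    simp at hlk
  have hkl : 0 < k / l := by
    rw [← mul_div_mul_right k l hl0]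
    exact div_pos hlk (mul_self_pos.mpr hl0)
  have hα : √(k / l) ^ 2 * l = k := by
    rw [Real.sq_sqrt hkl.le]
    field_simp
  have ha : g * l / k * k = g * l := div_mul_cancel₀ _ hk
  refine Or.inr (Or.inr (Or.inr ⟨g * l / k, ?_, AffinelyEquivalent.of_substitution (M := k * l)
    (N := m) (a := √(k / l)) (b := 0) (c := 0) (d := l) (s := 0) (t := 0) hlk.ne' ?_
    fun x y => ?_⟩))
  · have h1 : (g * l / k) ^ 2 * (d * k) = g ^ 2 := by
      rw [div_pow, mul_pow]
      field_simp
      linear_combination g ^ 2 * hl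
    by_contra hle
    nlinarith
  · rw [mul_zero, sub_zero]
    exact mul_ne_zero (Real.sqrt_pos.mpr hkl).ne' hl0
  · simp only [eval_biquadratic]
    generalize √(k / l) = α at *
    linear_combination x ^ 2 * y ^ 2 * l * hα + y ^ 3 * l * hl - l * y ^ 2 * ha

/-- Tameness leaves x²y² + r(y), whose critical points on x = 0 are the roots of r'. Having none
excludes degrees 4 and 2 for r, so r is a cubic. -/
theorem classified_biquadratic_of_nonconstant (hr : ε ≠ 0 ∨ d ≠ 0 ∨ g ≠ 0) :
    Classified (biquadratic ε 0 d e f g h k m).eval := by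
  by_cases he : e = 0
  swap
  · exact (tame_biquadratic_of_sq hr he).classified
  subst he
  by_cases hh : h = 0
  swap
  · exact (tame_biquadratic_of_linear hr hh).classified
  subst hh
  intro hs _
  obtain ⟨rfl, hk⟩ := biquadratic_coeffs_of_isPlaneSubmersion hs
  have hroot : ∀ y, 4 * ε * y ^ 3 + 3 * d * y ^ 2 + 2 * g * y + k ≠ 0 := by
    intro y hy
    refine dy_ne_zero hs (x := 0) (y := y) ?_ ?_
    · rw [dx_biquadratic]
      ring
    · rw [dy_biquadratic]
      linear_combination hy
  have hε : ε = 0 := by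
    by_contra hε
    obtain ⟨y, hy⟩ := exists_root_of_cubic (mul_ne_zero four_ne_zero hε) (3 * d) (2 * g) k
    exact hroot y hy
  subst hε
  have hd : d ≠ 0 := by
    rintro rfl
    have hg : g ≠ 0 := by simpa using hr
    refine hroot (-k / (2 * g)) ?_
    field_simp
    ring
  exact isNormalizable_biquadratic_of_cubic hd hs

theorem isNormalizable_biquadratic_of_linear (hk : k ≠ 0) :
    IsNormalizable (biquadratic 0 0 0 0 0 0 0 k m).eval := by
  refine Or.inr (Or.inr (Or.inl (AffinelyEquivalent.of_substitution (M := k * k) (N := m)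
    (a := 1) (b := 0) (c := 0) (d := k) (s := 0) (t := 0) (mul_ne_zero hk hk) (by simpa using hk)
    fun x y => ?_)))
  simp only [eval_biquadratic]
  ring

/-- When ε = 0 the family is stable under exchanging x and y, which reduces every nontame case to
one without x³. -/
theorem classified_biquadratic (ε a d e f g h k m : ℝ) :
    Classified (biquadratic ε a d e f g h k m).eval := by
  by_cases ha : a = 0
  swap
  · by_cases hr : ε ≠ 0 ∨ d ≠ 0
    · exact (tame_biquadratic ha hr).classified
    · push Not at hr
      obtain ⟨rfl, rfl⟩ := hr
      exact (biquadratic_comp_swap a 0 e f g h k m).classified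
        (classified_biquadratic_of_nonconstant (Or.inr (Or.inl ha)))
  subst ha
  by_cases hr : ε ≠ 0 ∨ d ≠ 0 ∨ g ≠ 0
  · exact classified_biquadratic_of_nonconstant hr
  push Not at hr
  obtain ⟨rfl, rfl, rfl⟩ := hr
  have hswap := biquadratic_comp_swap 0 0 e f 0 h k m
  by_cases he : e = 0
  swap
  · exact hswap.classified (classified_biquadratic_of_nonconstant (Or.inr (Or.inr he)))
  subst he
  by_cases hh : h = 0
  · subst hh
    intro hs _
    obtain ⟨rfl, hk⟩ := biquadratic_coeffs_of_isPlaneSubmersion hs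
    exact isNormalizable_biquadratic_of_linear hk
  by_cases hk : k = 0
  · subst hk
    refine hswap.classified ?_
    intro hs _
    obtain ⟨rfl, hk⟩ := biquadratic_coeffs_of_isPlaneSubmersion hs
    exact isNormalizable_biquadratic_of_linear hk
  · exact (tame_biquadratic_of_linear_of_linear hh hk).classified

end Biquadratic

/-! ### Reduction to the normal forms of the leading form -/

/-- The substitution sends the first basis vector to (u, v). The new x⁴ coefficient is thus the
leading form at (u, v), and the new x³y coefficient its derivative there along (-v, u). -/
theorem affinelyEquivalent_rotate (Q : QuarticCoeffs) {u v : ℝ} (huv : u ^ 2 + v ^ 2 ≠ 0) :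
    AffinelyEquivalent Q.eval (QuarticCoeffs.eval
    { a40 := Q.a40 * u ^ 4 + Q.a31 * u ^ 3 * v + Q.a22 * u ^ 2 * v ^ 2 + Q.a13 * u * v ^ 3 +
        Q.a04 * v ^ 4
      a31 := -4 * Q.a40 * u ^ 3 * v - 3 * Q.a31 * u ^ 2 * v ^ 2 + Q.a31 * u ^ 4 -
        2 * Q.a22 * u * v ^ 3 + 2 * Q.a22 * u ^ 3 * v - Q.a13 * v ^ 4 + 3 * Q.a13 * u ^ 2 * v ^ 2 +
        4 * Q.a04 * u * v ^ 3
      a22 := 6 * Q.a40 * u ^ 2 * v ^ 2 + 3 * Q.a31 * u * v ^ 3 - 3 * Q.a31 * u ^ 3 * v +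
        Q.a22 * v ^ 4 - 4 * Q.a22 * u ^ 2 * v ^ 2 + Q.a22 * u ^ 4 - 3 * Q.a13 * u * v ^ 3 +
        3 * Q.a13 * u ^ 3 * v + 6 * Q.a04 * u ^ 2 * v ^ 2
      a13 := -4 * Q.a40 * u * v ^ 3 - Q.a31 * v ^ 4 + 3 * Q.a31 * u ^ 2 * v ^ 2 +
        2 * Q.a22 * u * v ^ 3 - 2 * Q.a22 * u ^ 3 * v - 3 * Q.a13 * u ^ 2 * v ^ 2 + Q.a13 * u ^ 4 +
        4 * Q.a04 * u ^ 3 * v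
      a04 := Q.a40 * v ^ 4 - Q.a31 * u * v ^ 3 + Q.a22 * u ^ 2 * v ^ 2 - Q.a13 * u ^ 3 * v +
        Q.a04 * u ^ 4
      a30 := Q.a30 * u ^ 3 + Q.a21 * u ^ 2 * v + Q.a12 * u * v ^ 2 + Q.a03 * v ^ 3
      a21 := -3 * Q.a30 * u ^ 2 * v - 2 * Q.a21 * u * v ^ 2 + Q.a21 * u ^ 3 - Q.a12 * v ^ 3 +
        2 * Q.a12 * u ^ 2 * v + 3 * Q.a03 * u * v ^ 2
      a12 := 3 * Q.a30 * u * v ^ 2 + Q.a21 * v ^ 3 - 2 * Q.a21 * u ^ 2 * v -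
        2 * Q.a12 * u * v ^ 2 + Q.a12 * u ^ 3 + 3 * Q.a03 * u ^ 2 * v
      a03 := -Q.a30 * v ^ 3 + Q.a21 * u * v ^ 2 - Q.a12 * u ^ 2 * v + Q.a03 * u ^ 3
      a20 := Q.a20 * u ^ 2 + Q.a11 * u * v + Q.a02 * v ^ 2
      a11 := -2 * Q.a20 * u * v - Q.a11 * v ^ 2 + Q.a11 * u ^ 2 + 2 * Q.a02 * u * v
      a02 := Q.a20 * v ^ 2 - Q.a11 * u * v + Q.a02 * u ^ 2
      a10 := Q.a10 * u + Q.a01 * v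
      a01 := -Q.a10 * v + Q.a01 * u
      a00 := Q.a00 }) := by
  refine AffinelyEquivalent.of_substitution (M := 1) (N := 0) (a := u) (b := -v) (c := v) (d := u)
    (s := 0) (t := 0) one_ne_zero (by convert huv using 1; ring) fun x y => ?_
  simp only [eval]
  ring

theorem affinelyEquivalent_scale (h40 : Q.a40 = 0) (h31 : Q.a31 = 0) (h22 : Q.a22 ≠ 0) :
    ∃ Q' : QuarticCoeffs, Q'.a40 = 0 ∧ Q'.a31 = 0 ∧ Q'.a22 = 1 ∧
      AffinelyEquivalent Q.eval Q'.eval := by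
  refine ⟨⟨0, 0, 1, Q.a13 / Q.a22, Q.a04 / Q.a22, Q.a30 / Q.a22, Q.a21 / Q.a22, Q.a12 / Q.a22,
    Q.a03 / Q.a22, Q.a20 / Q.a22, Q.a11 / Q.a22, Q.a02 / Q.a22, Q.a10 / Q.a22, Q.a01 / Q.a22,
    Q.a00 / Q.a22⟩, rfl, rfl, rfl, AffinelyEquivalent.of_substitution (M := Q.a22) (N := 0) (a := 1)
    (b := 0) (c := 0) (d := 1) (s := 0) (t := 0) h22 (by norm_num) fun x y => ?_⟩
  simp only [eval, h40, h31]
  field_simp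
  ring

theorem affinelyEquivalent_shear (h40 : Q.a40 = 0) (h31 : Q.a31 = 0) (h22 : Q.a22 = 1) :
    ∃ Q' : QuarticCoeffs, Q'.a40 = 0 ∧ Q'.a31 = 0 ∧ Q'.a22 = 1 ∧ Q'.a13 = 0 ∧
      AffinelyEquivalent Q.eval Q'.eval := by
  obtain ⟨s, hs⟩ : ∃ s, 2 * s + Q.a13 = 0 := ⟨-Q.a13 / 2, by ring⟩
  refine ⟨
    { a40 := 0
      a31 := 0
      a22 := 1
      a13 := 2 * s + Q.a13
      a04 := s ^ 2 + Q.a13 * s + Q.a04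
      a30 := Q.a30
      a21 := 3 * Q.a30 * s + Q.a21
      a12 := 3 * Q.a30 * s ^ 2 + 2 * Q.a21 * s + Q.a12
      a03 := Q.a30 * s ^ 3 + Q.a21 * s ^ 2 + Q.a12 * s + Q.a03
      a20 := Q.a20
      a11 := 2 * Q.a20 * s + Q.a11
      a02 := Q.a20 * s ^ 2 + Q.a11 * s + Q.a02
      a10 := Q.a10
      a01 := Q.a10 * s + Q.a01
      a00 := Q.a00 },
    rfl, rfl, rfl, hs, AffinelyEquivalent.of_substitution (M := 1) (N := 0) (a := 1) (b := s)
      (c := 0) (d := 1) (s := 0) (t := 0) one_ne_zero (by norm_num) fun x y => ?_⟩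
  simp only [eval, h40, h31, h22]
  ring

theorem affinelyEquivalent_translate (h40 : Q.a40 = 0) (h31 : Q.a31 = 0) (h22 : Q.a22 = 1)
    (h13 : Q.a13 = 0) :
    ∃ Q' : QuarticCoeffs, Q'.a40 = 0 ∧ Q'.a31 = 0 ∧ Q'.a22 = 1 ∧ Q'.a13 = 0 ∧ Q'.a21 = 0 ∧
      Q'.a12 = 0 ∧ AffinelyEquivalent Q.eval Q'.eval := by
  obtain ⟨s, hs⟩ : ∃ s, 2 * s + Q.a12 = 0 := ⟨-Q.a12 / 2, by ring⟩
  obtain ⟨t, ht⟩ : ∃ t, 2 * t + Q.a21 = 0 := ⟨-Q.a21 / 2, by ring⟩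
  refine ⟨
    { a40 := 0
      a31 := 0
      a22 := 1
      a13 := 0
      a04 := Q.a04
      a30 := Q.a30
      a21 := 2 * t + Q.a21
      a12 := 2 * s + Q.a12
      a03 := 4 * Q.a04 * t + Q.a03
      a20 := t ^ 2 + 3 * Q.a30 * s + Q.a21 * t + Q.a20
      a11 := 4 * s * t + 2 * Q.a21 * s + 2 * Q.a12 * t + Q.a11
      a02 := s ^ 2 + 6 * Q.a04 * t ^ 2 + Q.a12 * s + 3 * Q.a03 * t + Q.a02
      a10 := 2 * s * t ^ 2 + 3 * Q.a30 * s ^ 2 + 2 * Q.a21 * s * t + Q.a12 * t ^ 2 +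
        2 * Q.a20 * s + Q.a11 * t + Q.a10
      a01 := 2 * s ^ 2 * t + 4 * Q.a04 * t ^ 3 + Q.a21 * s ^ 2 + 2 * Q.a12 * s * t +
        3 * Q.a03 * t ^ 2 + Q.a11 * s + 2 * Q.a02 * t + Q.a01
      a00 := s ^ 2 * t ^ 2 + Q.a04 * t ^ 4 + Q.a30 * s ^ 3 + Q.a21 * s ^ 2 * t +
        Q.a12 * s * t ^ 2 + Q.a03 * t ^ 3 + Q.a20 * s ^ 2 + Q.a11 * s * t + Q.a02 * t ^ 2 +
        Q.a10 * s + Q.a01 * t + Q.a00 },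
    rfl, rfl, rfl, rfl, ht, hs, AffinelyEquivalent.of_substitution (M := 1) (N := 0) (a := 1)
      (b := 0) (c := 0) (d := 1) (s := s) (t := t) one_ne_zero (by norm_num) fun x y => ?_⟩
  simp only [eval, h40, h31, h22, h13]
  ring

theorem exists_biquadratic (h40 : Q.a40 = 0) (h31 : Q.a31 = 0) (h22 : Q.a22 ≠ 0) :
    ∃ ε a d e f g h k m, AffinelyEquivalent Q.eval (biquadratic ε a d e f g h k m).eval := by
  obtain ⟨Q₁, h40, h31, h22, e₁⟩ := affinelyEquivalent_scale h40 h31 h22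
  obtain ⟨Q₂, h40, h31, h22, h13, e₂⟩ := affinelyEquivalent_shear h40 h31 h22
  obtain ⟨Q₃, h40, h31, h22, h13, h21, h12, e₃⟩ := affinelyEquivalent_translate h40 h31 h22 h13
  refine ⟨Q₃.a04, Q₃.a30, Q₃.a03, Q₃.a20, Q₃.a11, Q₃.a02, Q₃.a10, Q₃.a01, Q₃.a00, ?_⟩
  convert e₁.trans (e₂.trans e₃) using 1
  ext ⟨x, y⟩
  simp only [eval, biquadratic, h40, h31, h22, h13, h21, h12]

theorem classified_of_a40_a31 (h40 : Q.a40 = 0) (h31 : Q.a31 = 0)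
    (h : Q.a22 ≠ 0 ∨ Q.a13 ≠ 0 ∨ Q.a04 ≠ 0) : Classified Q.eval := by
  by_cases h22 : Q.a22 = 0
  · by_cases h13 : Q.a13 = 0
    · exact classified_of_y4 h40 h31 h22 h13 (by simpa [h22, h13] using h)
    · exact classified_of_xy3 h40 h31 h22 h13
  · obtain ⟨ε, a, d, e, f, g, h, k, m, heq⟩ := exists_biquadratic h40 h31 h22
    exact heq.classified (classified_biquadratic ε a d e f g h k m)

theorem classified_of_leading_ne_zero (Q : QuarticCoeffs)
    (hQ : ¬ (Q.a40 = 0 ∧ Q.a31 = 0 ∧ Q.a22 = 0 ∧ Q.a13 = 0 ∧ Q.a04 = 0)) :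
    Classified Q.eval := by
  by_cases h : ∀ x y, 4 * Q.a40 * x ^ 3 + 3 * Q.a31 * x ^ 2 * y + 2 * Q.a22 * x * y ^ 2 +
        Q.a13 * y ^ 3 = 0 →
      Q.a31 * x ^ 3 + 2 * Q.a22 * x ^ 2 * y + 3 * Q.a13 * x * y ^ 2 + 4 * Q.a04 * y ^ 3 = 0 →
      x = 0 ∧ y = 0
  · exact (tame_of_leadingForm h).classified
  push Not at h
  obtain ⟨u, v, h1, h2, h3⟩ := h
  have huv : 0 < u ^ 2 + v ^ 2 := by
    by_cases hu : u = 0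
    · have := h3 hu
      positivity
    · positivity
  -- Euler's identity for a form of degree four.
  have e40 : Q.a40 * u ^ 4 + Q.a31 * u ^ 3 * v + Q.a22 * u ^ 2 * v ^ 2 + Q.a13 * u * v ^ 3 +
      Q.a04 * v ^ 4 = 0 := by linear_combination (u * h1 + v * h2) / 4
  refine (affinelyEquivalent_rotate Q huv.ne').classified (classified_of_a40_a31 e40 ?_ ?_)
  · linear_combination u * h2 - v * h1
  · by_contra! hall
    obtain ⟨e22, e13, e04⟩ := hall
    have hlead : ∀ x y, Q.a40 * x ^ 4 + Q.a31 * x ^ 3 * y + Q.a22 * x ^ 2 * y ^ 2 +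
        Q.a13 * x * y ^ 3 + Q.a04 * y ^ 4 = 0 := by
      intro x y
      -- Undoing the rotation: were all rotated leading coefficients zero, the original leading form
      -- would vanish identically, and five values then kill its coefficients.
      refine (mul_eq_zero.mp (?_ : (u ^ 2 + v ^ 2) ^ 4 * _ = 0)).resolve_left (by positivity)
      linear_combination (u * x + v * y) ^ 4 * e40 +
        (u * x + v * y) ^ 3 * (u * y - v * x) * (u * h2 - v * h1) +
        (u * x + v * y) ^ 2 * (u * y - v * x) ^ 2 * e22 +
        (u * x + v * y) * (u * y - v * x) ^ 3 * e13 + (u * y - v * x) ^ 4 * e04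
    have l1 := hlead 1 0
    have l2 := hlead 0 1
    have l3 := hlead 1 1
    have l4 := hlead 1 (-1)
    have l5 := hlead 1 2
    norm_num at l1 l2 l3 l4 l5
    exact hQ ⟨l1, by linarith, by linarith, by linarith, l2⟩

/-! ### From `MvPolynomial` to coefficients -/

/-- The coefficients of a bivariate polynomial up to degree four. -/
noncomputable def ofMvPolynomial (P : MvPolynomial (Fin 2) ℝ) : QuarticCoeffs :=
  let c : ℕ → ℕ → ℝ := fun i j => P.coeff (Finsupp.equivFunOnFinite.symm ![i, j])
  { a40 := c 4 0, a31 := c 3 1, a22 := c 2 2, a13 := c 1 3, a04 := c 0 4, a30 := c 3 0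
    a21 := c 2 1, a12 := c 1 2, a03 := c 0 3, a20 := c 2 0, a11 := c 1 1, a02 := c 0 2
    a10 := c 1 0, a01 := c 0 1, a00 := c 0 0 }

theorem eval_ofMvPolynomial {P : MvPolynomial (Fin 2) ℝ} (hP : P.totalDegree ≤ 4) (x y : ℝ) :
    MvPolynomial.eval ![x, y] P = (ofMvPolynomial P).eval (x, y) := by
  set φ : ℕ × ℕ → (Fin 2 →₀ ℕ) := fun n => Finsupp.equivFunOnFinite.symm ![n.1, n.2] with hφ
  have hinj : Function.Injective φ := by
    intro m n h
    have h0 := DFunLike.congr_fun h 0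
    have h1 := DFunLike.congr_fun h 1
    exact Prod.ext (by simpa [hφ] using h0) (by simpa [hφ] using h1)
  -- A square box of exponents turns the sum into an iterated one; the ten corner terms of total
  -- degree above four are discarded by `hzero`.
  have hsub : P.support ⊆ (Finset.range 5 ×ˢ Finset.range 5).image φ := by
    intro s hs
    have h1 := (MvPolynomial.le_totalDegree hs).trans hP
    rw [Finsupp.sum_fintype _ _ (fun _ => rfl), Fin.sum_univ_two] at h1
    refine Finset.mem_image.mpr ⟨(s 0, s 1), ?_, ?_⟩
    · simp only [Finset.mem_product, Finset.mem_range]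
      omega
    · ext i
      fin_cases i <;> simp [hφ]
  have hzero : ∀ i j, 4 < i + j → P.coeff (φ (i, j)) = 0 := by
    intro i j hij
    refine MvPolynomial.coeff_eq_zero_of_totalDegree_lt ?_
    refine hP.trans_lt ?_
    have : ∑ l ∈ (φ (i, j)).support, φ (i, j) l = (φ (i, j)).sum fun _ e => e := rfl
    rw [this, Finsupp.sum_fintype _ _ (fun _ => rfl), Fin.sum_univ_two]
    simpa [hφ] using hij
  rw [MvPolynomial.eval_eq', Finset.sum_subset hsub (fun s _ hs => by
    rw [MvPolynomial.notMem_support_iff.mp hs, zero_mul]), Finset.sum_image hinj.injOn,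
    Finset.sum_product]
  simp only [Finset.sum_range_succ, Finset.sum_range_zero, Fin.prod_univ_two]
  rw [hzero 1 4 (by norm_num), hzero 2 3 (by norm_num), hzero 2 4 (by norm_num),
    hzero 3 2 (by norm_num), hzero 3 3 (by norm_num), hzero 3 4 (by norm_num),
    hzero 4 1 (by norm_num), hzero 4 2 (by norm_num), hzero 4 3 (by norm_num),
    hzero 4 4 (by norm_num)]
  simp only [eval, ofMvPolynomial, hφ]
  simp
  ring

theorem leading_ne_zero_of_totalDegree {P : MvPolynomial (Fin 2) ℝ} (hP : P.totalDegree = 4) :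
    ¬ ((ofMvPolynomial P).a40 = 0 ∧ (ofMvPolynomial P).a31 = 0 ∧ (ofMvPolynomial P).a22 = 0 ∧
      (ofMvPolynomial P).a13 = 0 ∧ (ofMvPolynomial P).a04 = 0) := by
  rintro ⟨h40, h31, h22, h13, h04⟩
  have hlt : P.totalDegree < 4 := by
    rw [MvPolynomial.totalDegree, Finset.sup_lt_iff (by norm_num)]
    intro s hs
    have h1 := (MvPolynomial.le_totalDegree hs).trans hP.le
    refine lt_of_le_of_ne h1 fun h2 => MvPolynomial.mem_support_iff.mp hs ?_
    rw [Finsupp.sum_fintype _ _ (fun _ => rfl), Fin.sum_univ_two] at h1 h2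
    have hs' : s = Finsupp.equivFunOnFinite.symm ![s 0, s 1] := by
      ext i
      fin_cases i <;> simp
    generalize s 0 = i at *
    generalize s 1 = j at *
    subst hs'
    have hi : i ≤ 4 := by omega
    interval_cases i
    · obtain rfl : j = 4 := by omega
      exact h04
    · obtain rfl : j = 3 := by omega
      exact h13
    · obtain rfl : j = 2 := by omega
      exact h22
    · obtain rfl : j = 1 := by omega
      exact h31
    · obtain rfl : j = 0 := by omega
      exact h40
  omega

end QuarticCoeffs

theorem theorem1p2 (p : ℝ × ℝ → ℝ) (hdeg : IsPolynomialOfDegree p 4)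
    (hsub : IsPlaneSubmersion p) (hdis : HasDisconnectedLevelSet p) :
    AffinelyEquivalent p (fun (x, y) => y + x * y ^ 2 + y ^ 4) ∨
    (∃ a : ℝ, (a = 0 ∨ a = 1) ∧
      AffinelyEquivalent p (fun (x, y) => y + a * y ^ 2 + x * y ^ 3)) ∨
    AffinelyEquivalent p (fun (x, y) => y + x ^ 2 * y ^ 2) ∨
    (∃ a : ℝ, a ^ 2 < 3 ∧
      AffinelyEquivalent p (fun (x, y) => y + a * y ^ 2 + y ^ 3 + x ^ 2 * y ^ 2)) := by
  obtain ⟨P, hP, hpP⟩ := hdeg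
  have hp : p = (QuarticCoeffs.ofMvPolynomial P).eval := by
    ext ⟨x, y⟩
    rw [hpP, QuarticCoeffs.eval_ofMvPolynomial hP.le]
  subst hp
  exact QuarticCoeffs.classified_of_leading_ne_zero _
    (QuarticCoeffs.leading_ne_zero_of_totalDegree hP) hsub hdis
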